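/- **Setting.** Consider the real linear plant $$\dot x = Ax+Bu+Ew,\qquad z=Dx,\qquad x\in\mathbb R^n,\ u\in\mathbb R^r,\ w\in\mathbb R^p,\ z\in\mathbb R^d,$$ with $(A,D)$ observable. Let $\beta\ge 1$ and let $\tilde\varphi(s)=s^\beta+\alpha_{\beta-1}s^{\beta-1}+\dots+\alpha_0$ be a real polynomial all of whose complex roots have non-negative real part. The modelled disturbances $w$ and references $z_{\rm ref}$ are the signals on $[t_0,\infty)$ each of whose components $v$ satisfies $v^{(\beta)}+\alpha_{\beta-1}v^{(\beta-1)}+\dots+\alpha_0v=0$. Consider the servo-compensator $$\dot q=Fq+\Gamma(z-z_{\rm ref}),\qquad u=K_1x+K_2q,\qquad q\in\mathbb R^{d\beta},$$ with $F=\mathrm{diag}(F_1,\dots,F_d)$, $\Gamma=\mathrm{diag}(\gamma_1,\dots,\gamma_d)$, $F_i\in\mathbb R^{\beta\times\beta}$, $\gamma_i\in\mathbb R^{\beta}$ and $\det(sI-F_i)=\tilde\varphi(s)$ for every $i$. Put $$\tilde A_{\rm cl}=\begin{bmatrix}A+BK_1&BK_2\\ \Gamma D&F\end{bmatrix},$$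 $$G(s)=[D,\,0]\,(sI-\tilde A_{\rm cl})^{-1}\begin{bmatrix}0&E\\-\Gamma&0\end{bmatrix}-[I_d,\,0],$$ so that $G$ is the transfer matrix from $(z_{\rm ref},w)$ to the error $\varepsilon=z-z_{\rm ref}$. A matrix is called Hurwitz if all its eigenvalues have negative real part; a pair $(A,B)$ is stabilizable if $A+BK$ is Hurwitz for some real $K$. The compensator *achieves asymptotic tracking* if $z(t)-z_{\rm ref}(t)\to0$ as $t\to\infty$ for all $t_0$, all modelled $w$ and $z_{\rm ref}$ and all initial states $x(t_0)$, $q(t_0)$. A complex number $s$ is a *transmission zero* of $(A,B,D)$ if $\operatorname{rank}N(s)<\min(d,r)$, where $D(sI-A)^{-1}B=N(s)M(s)^{-1}$ is a factorization into relatively right prime real polynomial matrices (this does not depend on the factorization). A real rational function is called divisible by $\tilde\varphi$ if $\tilde\varphi$ divides its numerator in lowest terms. **Theorem.** 1. For arbitrary real matrices $F,\Gamma,K_1,K_2$ of the above sizes (without the block structure and the condition on $\det(sI-F_i)$): if $\tilde A_{\rm cl}$ is Hurwitz and all entries of $G$ are divisible by $\tilde\varphi$, then the compensator achieves asymptotic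 tracking. 2. For $F,\Gamma$ as above and any $K_1,K_2$: if no root of $\tilde\varphi$ is an eigenvalue of $\tilde A_{\rm cl}$, then all entries of $G$ are divisible by $\tilde\varphi$. 3. For $F,\Gamma$ as above, the pair $\left(\begin{bmatrix}A&0\\ \Gamma D&F\end{bmatrix},\begin{bmatrix}B\\0\end{bmatrix}\right)$ is stabilizable if and only if (a) $(A,B)$ is stabilizable, (b) $d\le r$, (c) no root of $\tilde\varphi$ is a transmission zero of $(A,B,D)$, and (d) each pair $(F_i,\gamma_i)$, $i=1,\dots,d$, is stabilizable. 4. If (a)–(d) hold, then there are real matrices $K_1,K_2$ such that $\tilde A_{\rm cl}$ is Hurwitz and the compensator achieves asymptotic tracking. -/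

import Mathlib

open Filter Topology Polynomial

/-- All eigenvalues of the real square matrix `M` have negative real part. -/
def IsHurwitz {m : Type*} [Fintype m] [DecidableEq m] (M : Matrix m m ℝ) : Prop :=
  ∀ s : ℂ, aeval s M.charpoly = 0 → s.re < 0

/-- The pair `(A, B)` is stabilizable: some state feedback makes `A + B K` Hurwitz. -/
def IsStabilizable {m k : Type*} [Fintype m] [DecidableEq m] [Fintype k]
    (A : Matrix m m ℝ) (B : Matrix m k ℝ) : Prop :=
  ∃ K : Matrix k m ℝ, IsHurwitz (A + B * K)

/-- The pair `(A, C)` is observable: the common kernel of `C, CA, CA², …`, which is the kernel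
of the observability matrix, is trivial. -/
def IsObservablePair {m l : Type*} [Fintype m] [DecidableEq m]
    (A : Matrix m m ℝ) (C : Matrix l m ℝ) : Prop :=
  ∀ v : m → ℝ, (∀ k : ℕ, (C * A ^ k).mulVec v = 0) → v = 0

/-- The transfer function matrix `C (s I - A)⁻¹ B + J` of the system
`x' = A x + B v`, `y = C x + J v`, a matrix of real rational functions
(`A.charmatrix` is the polynomial matrix `s I - A`). -/
noncomputable def transferMatrix {m k l : Type*} [Fintype m] [DecidableEq m]
    (A : Matrix m m ℝ) (B : Matrix m k ℝ) (C : Matrix l m ℝ) (J : Matrix l k ℝ) :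
    Matrix l k (RatFunc ℝ) :=
  C.map RatFunc.C * (A.charmatrix.map (algebraMap ℝ[X] (RatFunc ℝ)))⁻¹ * B.map RatFunc.C
    + J.map RatFunc.C

/-- `G = N M⁻¹` is a factorization of the rational matrix `G` into relatively right prime
polynomial matrices, so that `N` is a numerator of `G`. -/
def IsRightCoprimeFactorization {l k : Type*} [Fintype l] [DecidableEq l] [Fintype k]
    [DecidableEq k] (G : Matrix l k (RatFunc ℝ)) (N : Matrix l k ℝ[X]) (M : Matrix k k ℝ[X]) :
    Prop :=
  M.det ≠ 0 ∧
  G = N.map (algebraMap ℝ[X] (RatFunc ℝ)) * (M.map (algebraMap ℝ[X] (RatFunc ℝ)))⁻¹ ∧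
  ∃ (X : Matrix k l ℝ[X]) (Y : Matrix k k ℝ[X]), X * N + Y * M = 1

/-- The complex number `s` is a transmission zero of the `l × k` rational matrix `G`: a numerator
of `G` has at `s` a rank below `min(l, k)`. Numerators are unique up to unimodular factors, so the
choice of the numerator does not matter; where `G` has full normal rank these are the zeros of the
numerator polynomials in its Smith–McMillan form, and `s` is allowed to be a pole of `G`. If the
normal rank of `G` is below `min(l, k)`, then every `s` counts as a transmission zero. -/
def IsTransmissionZero {l k : Type*} [Fintype l] [DecidableEq l] [Fintype k] [DecidableEq k]
    (G : Matrix l k (RatFunc ℝ)) (s : ℂ) : Prop :=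
  ∃ (N : Matrix l k ℝ[X]) (M : Matrix k k ℝ[X]), IsRightCoprimeFactorization G N M ∧
    (N.map (aeval s)).rank < min (Fintype.card l) (Fintype.card k)

/-- On `[t₀, ∞)` the scalar signal `v` satisfies the homogeneous linear differential equation
whose characteristic polynomial is `φ`. -/
def SatisfiesModel (φ : ℝ[X]) (t₀ : ℝ) (v : ℝ → ℝ) : Prop :=
  ContDiffOn ℝ φ.natDegree v (Set.Ici t₀) ∧
  ∀ t ∈ Set.Ici t₀, ∑ k ∈ Finset.range (φ.natDegree + 1),
    φ.coeff k * iteratedDerivWithin k v (Set.Ici t₀) t = 0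

section Servo

variable {n r d p β : ℕ}

/-- The quasi-diagonal matrix `Γ = diag(γ₁, …, γ_d)` with the columns `γ_i` as blocks. -/
def servoGamma (γ : Fin d → Fin β → ℝ) : Matrix (Fin β × Fin d) (Fin d) ℝ :=
  Matrix.of fun a j => if a.2 = j then γ j a.1 else 0

/-- The dynamics matrix of the plant augmented by the compensator, without feedback. -/
def augmentedA {κ : Type*} (A : Matrix (Fin n) (Fin n) ℝ) (D : Matrix (Fin d) (Fin n) ℝ)
    (F : Matrix κ κ ℝ) (Γ : Matrix κ (Fin d) ℝ) : Matrix (Fin n ⊕ κ) (Fin n ⊕ κ) ℝ :=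
  Matrix.fromBlocks A 0 (Γ * D) F

/-- The control matrix of the augmented plant. -/
def augmentedB (κ : Type*) (B : Matrix (Fin n) (Fin r) ℝ) : Matrix (Fin n ⊕ κ) (Fin r) ℝ :=
  Matrix.fromRows B 0

/-- The dynamics matrix of the closed loop, with state `(x, q)` and feedback
`u = K₁ x + K₂ q`. -/
def closedLoop {κ : Type*} (A : Matrix (Fin n) (Fin n) ℝ) (B : Matrix (Fin n) (Fin r) ℝ)
    (D : Matrix (Fin d) (Fin n) ℝ) (F : Matrix κ κ ℝ) (Γ : Matrix κ (Fin d) ℝ)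
    (K₁ : Matrix (Fin r) (Fin n) ℝ) (K₂ : Matrix (Fin r) κ ℝ) :
    Matrix (Fin n ⊕ κ) (Fin n ⊕ κ) ℝ :=
  Matrix.fromBlocks (A + B * K₁) (B * K₂) (Γ * D) F

/-- The transfer function matrix of the closed loop from the exogenous input `(z_ref, w)` to the
tracking error `ε = D x - z_ref`. -/
noncomputable def errorTransfer {κ : Type*} [Fintype κ] [DecidableEq κ]
    (A : Matrix (Fin n) (Fin n) ℝ) (B : Matrix (Fin n) (Fin r) ℝ)
    (E : Matrix (Fin n) (Fin p) ℝ) (D : Matrix (Fin d) (Fin n) ℝ) (F : Matrix κ κ ℝ)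
    (Γ : Matrix κ (Fin d) ℝ) (K₁ : Matrix (Fin r) (Fin n) ℝ) (K₂ : Matrix (Fin r) κ ℝ) :
    Matrix (Fin d) (Fin d ⊕ Fin p) (RatFunc ℝ) :=
  transferMatrix (closedLoop A B D F Γ K₁ K₂)
    (Matrix.fromBlocks 0 E (-Γ) 0 : Matrix (Fin n ⊕ κ) (Fin d ⊕ Fin p) ℝ)
    (Matrix.fromCols D 0 : Matrix (Fin d) (Fin n ⊕ κ) ℝ)
    (Matrix.fromCols (-1) 0 : Matrix (Fin d) (Fin d ⊕ Fin p) ℝ)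

/-- The compensator `q' = F q + Γ (z - z_ref)`, `u = K₁ x + K₂ q` achieves asymptotic tracking in
the plant `x' = A x + B u + E w`, `z = D x`: whatever the initial time, the initial states of plant
and compensator, and the disturbance `w` and reference `z_ref` with components that satisfy the
model `φ`, one has `z(t) - z_ref(t) → 0`. -/
def AchievesTracking {κ : Type*} [Fintype κ] (φ : ℝ[X])
    (A : Matrix (Fin n) (Fin n) ℝ) (B : Matrix (Fin n) (Fin r) ℝ)
    (E : Matrix (Fin n) (Fin p) ℝ) (D : Matrix (Fin d) (Fin n) ℝ) (F : Matrix κ κ ℝ)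
    (Γ : Matrix κ (Fin d) ℝ) (K₁ : Matrix (Fin r) (Fin n) ℝ) (K₂ : Matrix (Fin r) κ ℝ) : Prop :=
  ∀ (t₀ : ℝ) (w : ℝ → Fin p → ℝ) (zref : ℝ → Fin d → ℝ) (x : ℝ → Fin n → ℝ) (q : ℝ → κ → ℝ),
    (∀ i, SatisfiesModel φ t₀ (fun t => w t i)) →
    (∀ i, SatisfiesModel φ t₀ (fun t => zref t i)) →
    (∀ t ∈ Set.Ici t₀, HasDerivWithinAt x
      (A.mulVec (x t) + B.mulVec (K₁.mulVec (x t) + K₂.mulVec (q t)) + E.mulVec (w t))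
      (Set.Ici t₀) t) →
    (∀ t ∈ Set.Ici t₀, HasDerivWithinAt q
      (F.mulVec (q t) + Γ.mulVec (D.mulVec (x t) - zref t)) (Set.Ici t₀) t) →
    Tendsto (fun t => D.mulVec (x t) - zref t) atTop (𝓝 0)

end Servo

/-!
The proof rests on the Hautus test: a pair `(A, B)` is stabilizable if and only if no left
eigenvector of `A` for an eigenvalue in the closed right half-plane is annihilated by `B`
(`isStabilizable_iff_hautusAt`). For the existence of a stabilizing feedback, a real eigenvalue or a
pair of conjugate eigenvalues is moved to `-1` by a feedback that factors through the invariant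
space of row vectors of that eigenvalue and therefore leaves the rest of the spectrum in place
(`charpoly_add_mul_of_intertwine`).

*Tracking.* Let differentiation act on smooth signals, so that polynomial matrices act on vectors of
signals. Elimination of the state shows that the error `ε` of a closed loop with characteristic
polynomial `P` and error transfer matrix `N / P` satisfies `P(d/dt) ε = N(d/dt) v` for the exogenous
input `v` (`polyAct_output`). If `φ` divides the entries of `N`, the right side vanishes, and `ε`
tends to zero because `P` is Hurwitz (`tendsto_zero_of_aeval`).

*Internal model.* The rows of block `i` of `(s I - Ã) Z = P G` read `(s I - F i) z = γ i N_i`, where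
`N_i` is an entry of row `i` of `N`. Substitution of `F i` for `s` gives `N_i(F i) (γ i) = 0`. The
vector `γ i` is cyclic for `F i`, as an uncontrollable eigenvalue of the block would be an
eigenvalue of the closed loop; hence the characteristic polynomial `φ` of `F i` divides `N_i`
(`charpoly_dvd_errorNumerator`). It does not cancel against `P`, as the two are coprime.

*Stabilizability.* A right coprime factorization `N M⁻¹` of the transfer matrix of the plant exists
(`exists_isRightCoprimeFactorization`), and observability lifts it to polynomial solutions of
`(s I - A) Z = B M`, `D Z = N` (`IsRightCoprimeFactorization.exists_state`). A count of dimensions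
then shows that `η N(s) = 0` if and only if `w (s I - A) = η D` and `w B = 0` for some `w`
(`vecMul_numerator_eq_zero_iff`). With the left eigenvectors of the blocks, this identifies the
Hautus condition for the augmented pair at the roots of `φ` with the conditions on the plant, the
transmission zeros and the pairs `(F i, γ i)`. The existence of the compensator combines the three
parts.
-/

/-! ### The Hautus test for stabilizability -/

open Matrix in
/-- The Hautus condition for the pair `(A, B)` at the complex number `s`: the matrix `[s I - A, B]`
has full row rank, stated as: no left eigenvector of `A` for `s` is annihilated by `B`. -/
def HautusAt {m k : Type*} [Fintype m] (A : Matrix m m ℝ) (B : Matrix m k ℝ) (s : ℂ) : Prop :=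
  ∀ w : m → ℂ, w ᵥ* A.map (algebraMap ℝ ℂ) = s • w → w ᵥ* B.map (algebraMap ℝ ℂ) = 0 → w = 0

section Hautus

open Matrix

theorem aeval_charpoly_eq_zero_iff {K L m : Type*} [Field K] [Field L] [Algebra K L] [Fintype m]
    [DecidableEq m] (M : Matrix m m K) (s : L) :
    aeval s M.charpoly = 0 ↔ ∃ w : m → L, w ≠ 0 ∧ w ᵥ* M.map (algebraMap K L) = s • w := by
  rw [← eval_map_algebraMap, ← Matrix.charpoly_map, Matrix.eval_charpoly,
    ← Matrix.exists_vecMul_eq_zero_iff]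
  refine exists_congr fun w => and_congr_right fun _ => ?_
  rw [Matrix.vecMul_sub, sub_eq_zero, eq_comm]
  simp [Matrix.scalar_apply, ← Matrix.smul_one_eq_diagonal, Matrix.vecMul_smul]

/-- If the rows of `W` span an invariant space of row vectors of `A`, on which `A` acts by `Λ`, then
the feedback `H W` replaces the factor `Λ.charpoly` of `A.charpoly` by `(Λ + W H).charpoly`. -/
theorem charpoly_add_mul_of_intertwine {R m l : Type*} [CommRing R] [Fintype m] [DecidableEq m]
    [Fintype l] [DecidableEq l] (A : Matrix m m R) (Λ : Matrix l l R) (W : Matrix l m R)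
    (H : Matrix m l R) (h : W * A = Λ * W) :
    (A + H * W).charpoly * Λ.charpoly = A.charpoly * (Λ + W * H).charpoly := by
  -- both sides are characteristic polynomials of similar block triangular matrices
  have key : fromBlocks (A + H * W) H 0 Λ =
      fromBlocks 1 0 (-W) 1 * (fromBlocks A H 0 (Λ + W * H) * fromBlocks 1 0 W 1) := by
    simp only [fromBlocks_multiply]
    congr 1
    · simp
    · simp
    · simp only [Matrix.mul_zero, Matrix.mul_one, Matrix.one_mul, Matrix.mul_add,
        Matrix.neg_mul, h, Matrix.add_mul, Matrix.mul_assoc]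
      abel
    · simp
  rw [← charpoly_fromBlocks_zero₂₁ (A + H * W) H Λ, key, charpoly_mul_comm, Matrix.mul_assoc,
    fromBlocks_multiply]
  simp [charpoly_fromBlocks_zero₂₁]

open Classical in
/-- The number of complex roots of a real polynomial in the closed right half-plane, counted with
multiplicity. -/
noncomputable def unstableCount (p : ℝ[X]) : ℕ := ((p.aroots ℂ).filter fun s => 0 ≤ s.re).card

theorem unstableCount_mul {p q : ℝ[X]} (hp : p ≠ 0) (hq : q ≠ 0) :
    unstableCount (p * q) = unstableCount p + unstableCount q := by
  simp [unstableCount, aroots_mul (mul_ne_zero hp hq)]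

theorem unstableCount_eq_zero_iff {p : ℝ[X]} (hp : p ≠ 0) :
    unstableCount p = 0 ↔ ∀ s : ℂ, aeval s p = 0 → s.re < 0 := by
  simp [unstableCount, Multiset.filter_eq_nil, hp]

theorem isHurwitz_iff_unstableCount {m : Type*} [Fintype m] [DecidableEq m] (M : Matrix m m ℝ) :
    IsHurwitz M ↔ unstableCount M.charpoly = 0 :=
  (unstableCount_eq_zero_iff M.charpoly_monic.ne_zero).symm

theorem HautusAt.feedback {m k : Type*} [Fintype m] [Fintype k] {A : Matrix m m ℝ}
    {B : Matrix m k ℝ} {s : ℂ} (h : HautusAt A B s) (K : Matrix k m ℝ) : HautusAt (A + B * K) B s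
        := by
  intro w hw hB
  refine h w ?_ hB
  rw [Matrix.map_add _ (map_add _), Matrix.map_mul, vecMul_add, ← vecMul_vecMul, hB] at hw
  simpa using hw

variable {m k : Type*} [Fintype m] [DecidableEq m] [Fintype k]

/-- One step of the stabilization: an unstable invariant space of row vectors which the input can
stabilize is moved to the left half-plane, and the rest of the spectrum stays. -/
theorem exists_unstableCount_lt (A : Matrix m m ℝ) (B : Matrix m k ℝ) {l : ℕ}
    (Λ : Matrix (Fin l) (Fin l) ℝ) (W : Matrix (Fin l) m ℝ) (K : Matrix k (Fin l) ℝ)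
    (h : W * A = Λ * W) (s : ℂ) (hs : 0 ≤ s.re) (hΛ : aeval s Λ.charpoly = 0)
    (hK : IsHurwitz (Λ + W * (B * K))) :
    unstableCount (A + B * (K * W)).charpoly < unstableCount A.charpoly := by
  have e := congrArg unstableCount (charpoly_add_mul_of_intertwine A Λ W (B * K) h)
  rw [unstableCount_mul (charpoly_monic _).ne_zero (charpoly_monic _).ne_zero,
    unstableCount_mul (charpoly_monic _).ne_zero (charpoly_monic _).ne_zero,
    (isHurwitz_iff_unstableCount _).1 hK, Matrix.mul_assoc] at e
  have : unstableCount Λ.charpoly ≠ 0 := fun h0 =>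
    absurd ((isHurwitz_iff_unstableCount _).2 h0 s hΛ) (not_lt.2 hs)
  omega

/-- Some feedback moves an unstable eigenvalue `s` to `-1` if the Hautus condition holds at `s`. For
real `s` a real left eigenvector spans the invariant space of row vectors; otherwise its real and
imaginary parts do. A single column of `B` suffices as the input. -/
theorem HautusAt.exists_unstableCount_lt {A : Matrix m m ℝ} {B : Matrix m k ℝ} {s : ℂ}
    (h : HautusAt A B s) (hs : 0 ≤ s.re) (hA : aeval s A.charpoly = 0) :
    ∃ K : Matrix k m ℝ, unstableCount (A + B * K).charpoly < unstableCount A.charpoly := by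
  classical
  by_cases him : s.im = 0
  · obtain ⟨a, rfl⟩ : ∃ a : ℝ, s = algebraMap ℝ ℂ a := ⟨s.re, Complex.ext (by simp) (by simp [him])⟩
    rw [aeval_algebraMap_apply, map_eq_zero, aeval_charpoly_eq_zero_iff] at hA
    obtain ⟨u, hu0, hu⟩ := hA
    have huB : u ᵥ* B ≠ 0 := by
      intro h0
      refine hu0 (funext fun i => ?_)
      have := h (algebraMap ℝ ℂ ∘ u) ?_ ?_
      · simpa using congrFun this i
      · ext i
        rw [← RingHom.map_vecMul]
        simpa using congrArg (algebraMap ℝ ℂ) (congrFun hu i)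
      · ext i
        rw [← RingHom.map_vecMul, h0]
        simp
    obtain ⟨j, hj⟩ := Function.ne_iff.1 huB
    refine ⟨_, _root_.exists_unstableCount_lt A B (l := 1) (!![a]) (Matrix.of fun _ => u)
      (Matrix.of fun i _ => if i = j then (-1 - a) / (u ᵥ* B) j else 0) ?_ _ hs ?_ ?_⟩
    · ext i x
      have := congrFun hu x
      simpa [Matrix.mul_apply, vecMul, dotProduct] using this
    · simp [charpoly, charmatrix]
    · have : (!![a] + (Matrix.of fun _ => u : Matrix (Fin 1) m ℝ) * (B * (Matrix.of fun i _ =>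
          if i = j then (-1 - a) / (u ᵥ* B) j else 0 : Matrix k (Fin 1) ℝ))) = !![-1] := by
        ext x y
        rw [← Matrix.mul_assoc]
        have e : ∀ i z, ((Matrix.of fun _ => u : Matrix (Fin 1) m ℝ) * B) i z = (u ᵥ* B) z :=
          fun i z => rfl
        rw [Matrix.add_apply, Matrix.mul_apply]
        simp only [e]
        have : (u ᵥ* B) j ≠ 0 := hj
        simp
        field_simp
        ring
      rw [this]
      intro z hz
      simp [charpoly, charmatrix] at hz
      have : z = -1 := by linear_combination hz
      simp [this]
  · obtain ⟨w, hw0, hw⟩ := (aeval_charpoly_eq_zero_iff _ _).1 hA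
    set a := s.re
    set b := s.im
    set u : m → ℝ := fun i => (w i).re
    set v : m → ℝ := fun i => (w i).im
    have hu : ∀ i, (u ᵥ* A) i = a * u i - b * v i := by
      intro i
      have := congrArg Complex.re (congrFun hw i)
      simpa [vecMul, dotProduct, u, v, a, b] using this
    have hv : ∀ i, (v ᵥ* A) i = b * u i + a * v i := by
      intro i
      have := congrArg Complex.im (congrFun hw i)
      simp [vecMul, dotProduct] at this
      simp [vecMul, dotProduct, u, v, a, b, this]
      ring
    obtain ⟨j, hj⟩ : ∃ j, (u ᵥ* B) j ^ 2 + (v ᵥ* B) j ^ 2 ≠ 0 := by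
      by_contra! hc
      refine hw0 (h w hw (funext fun j => ?_))
      have h1 : (u ᵥ* B) j = 0 := by nlinarith [hc j, sq_nonneg ((u ᵥ* B) j), sq_nonneg ((v ᵥ* B)
          j)]
      have h2 : (v ᵥ* B) j = 0 := by nlinarith [hc j, sq_nonneg ((u ᵥ* B) j), sq_nonneg ((v ᵥ* B)
          j)]
      apply Complex.ext
      · simpa [vecMul, dotProduct, u] using h1
      · simpa [vecMul, dotProduct, v] using h2
    set g₁ := (u ᵥ* B) j with hg₁
    set g₂ := (v ᵥ* B) j with hg₂
    -- the gain is the one for which the `2 × 2` block gets the trace `-2` and the determinant `1`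
    set τ := -2 * a - 2
    set δ := (1 - a ^ 2 - b ^ 2 - a * τ) / b
    set k₁ := (τ * g₁ + δ * g₂) / (g₁ ^ 2 + g₂ ^ 2) with hk₁
    set k₂ := (τ * g₂ - δ * g₁) / (g₁ ^ 2 + g₂ ^ 2) with hk₂
    refine ⟨_, _root_.exists_unstableCount_lt A B (l := 2) (!![a, -b; b, a]) (Matrix.of ![u, v])
      (Matrix.of fun i x => if i = j then ![k₁, k₂] x else 0) ?_ s hs ?_ ?_⟩
    · ext i x
      fin_cases i
      · have := hu x
        simp [Matrix.mul_apply, vecMul, dotProduct] at this ⊢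
        rw [this]; ring
      · have := hv x
        simp [Matrix.mul_apply, vecMul, dotProduct] at this ⊢
        rw [this]
    · have hs' : s = a + b * Complex.I := (Complex.re_add_im s).symm
      simp [charpoly_fin_two, Matrix.trace_fin_two, Matrix.det_fin_two]
      rw [hs']
      linear_combination (b : ℂ) ^ 2 * Complex.I_sq
    · have : (!![a, -b; b, a] + (Matrix.of ![u, v] : Matrix (Fin 2) m ℝ) * (B * (Matrix.of fun i x
        =>
          if i = j then ![k₁, k₂] x else 0 : Matrix k (Fin 2) ℝ))) =
          !![a + g₁ * k₁, -b + g₁ * k₂; b + g₂ * k₁, a + g₂ * k₂] := by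
        rw [← Matrix.mul_assoc]
        have e1 : ∀ z, ((Matrix.of ![u, v] : Matrix (Fin 2) m ℝ) * B) 0 z = (u ᵥ* B) z :=
          fun z => rfl
        have e2 : ∀ z, ((Matrix.of ![u, v] : Matrix (Fin 2) m ℝ) * B) 1 z = (v ᵥ* B) z :=
          fun z => rfl
        ext x y
        rw [Matrix.add_apply, Matrix.mul_apply]
        fin_cases x <;> fin_cases y <;> simp [e1, e2, hg₁, hg₂]
      rw [this]
      have hT : a + g₁ * k₁ + (a + g₂ * k₂) = -2 := by
        rw [hk₁, hk₂]; simp only [τ]; field_simp; ring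
      have hD : (a + g₁ * k₁) * (a + g₂ * k₂) - (-b + g₁ * k₂) * (b + g₂ * k₁) = 1 := by
        have h1 : g₁ * k₁ + g₂ * k₂ = τ := by
          rw [hk₁, hk₂]; field_simp; ring
        have h2 : g₂ * k₁ - g₁ * k₂ = δ := by
          rw [hk₁, hk₂]; field_simp; ring
        have h3 : b * δ = 1 - a ^ 2 - b ^ 2 - a * τ := by
          simp only [δ]; field_simp
        linear_combination a * h1 + b * h2 + h3
      intro z hz
      rw [charpoly_fin_two, Matrix.trace_fin_two, Matrix.det_fin_two] at hz
      simp only [Matrix.of_apply, Matrix.cons_val', Matrix.cons_val_zero, Matrix.cons_val_one,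
        Matrix.cons_val_fin_one, hT, hD] at hz
      simp at hz
      have : (z + 1) ^ 2 = 0 := by linear_combination hz
      have : z = -1 := by linear_combination pow_eq_zero_iff (two_ne_zero) |>.1 this
      simp [this]

theorem IsStabilizable.hautusAt {A : Matrix m m ℝ} {B : Matrix m k ℝ} (h : IsStabilizable A B)
    {s : ℂ} (hs : 0 ≤ s.re) : HautusAt A B s := by
  obtain ⟨K, hK⟩ := h
  intro w hw hB
  by_contra h0
  refine absurd (hK s ((aeval_charpoly_eq_zero_iff _ _).2 ⟨w, h0, ?_⟩)) (not_lt.2 hs)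
  rw [Matrix.map_add _ (map_add _), Matrix.map_mul, vecMul_add, ← vecMul_vecMul, hB]
  simpa using hw

/-- Hautus test: a real pair is stabilizable if it satisfies the Hautus condition in the closed
right half-plane. The unstable eigenvalues are moved to `-1` one real eigenvalue, or one pair of
conjugate ones, at a time. -/
theorem isStabilizable_of_hautusAt {A : Matrix m m ℝ} {B : Matrix m k ℝ}
    (h : ∀ s : ℂ, 0 ≤ s.re → HautusAt A B s) : IsStabilizable A B := by
  induction hN : unstableCount A.charpoly using Nat.strong_induction_on generalizing A with
  | _ N ih =>
    by_cases hA : IsHurwitz A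
    · exact ⟨0, by simpa using hA⟩
    · simp only [IsHurwitz, not_forall, not_lt] at hA
      obtain ⟨s, hs0, hs⟩ := hA
      obtain ⟨K, hK⟩ := (h s hs).exists_unstableCount_lt hs hs0
      obtain ⟨K', hK'⟩ := ih _ (hN ▸ hK) (fun z hz => (h z hz).feedback K) rfl
      exact ⟨K + K', by rwa [Matrix.mul_add, ← add_assoc]⟩

theorem isStabilizable_iff_hautusAt {A : Matrix m m ℝ} {B : Matrix m k ℝ} :
    IsStabilizable A B ↔ ∀ s : ℂ, 0 ≤ s.re → HautusAt A B s :=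
  ⟨fun h _ hs => h.hautusAt hs, isStabilizable_of_hautusAt⟩

end Hautus

/-! ### Polynomial matrices acting on vectors of module elements -/

/-- The action of a polynomial matrix `Q` on a vector `e` of module elements, in which the
indeterminate acts as the operator `T`. -/
noncomputable def polyAct {R 𝓐 V l m : Type*} [CommRing R] [Ring 𝓐] [Algebra R 𝓐]
    [AddCommGroup V] [Module 𝓐 V] [Fintype m] (T : 𝓐) (Q : Matrix l m R[X]) (e : m → V) : l → V :=
  fun i => ∑ j, aeval T (Q i j) • e j

section PolyAct

variable {R 𝓐 V l m : Type*} [CommRing R] [Ring 𝓐] [Algebra R 𝓐] [AddCommGroup V]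
  [Module 𝓐 V] [Fintype m] (T : 𝓐)

theorem polyAct_mul {k : Type*} [Fintype k] (Q : Matrix l m R[X]) (Q' : Matrix m k R[X])
    (e : k → V) : polyAct T (Q * Q') e = polyAct T Q (polyAct T Q' e) := by
  ext i
  simp only [polyAct, Matrix.mul_apply, map_sum, map_mul, Finset.sum_smul, Finset.smul_sum,
    mul_smul]
  exact Finset.sum_comm

theorem polyAct_add (Q Q' : Matrix l m R[X]) (e : m → V) :
    polyAct T (Q + Q') e = polyAct T Q e + polyAct T Q' e := by
  ext i
  simp [polyAct, add_smul, Finset.sum_add_distrib]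

theorem polyAct_smul (p : R[X]) (Q : Matrix l m R[X]) (e : m → V) :
    polyAct T (p • Q) e = fun i => aeval T p • polyAct T Q e i := by
  ext i
  simp [polyAct, mul_smul, Finset.smul_sum]

theorem polyAct_charmatrix [DecidableEq m] (A : Matrix m m R) (e : m → V) :
    polyAct T A.charmatrix e = fun i => T • e i - ∑ j, algebraMap R 𝓐 (A i j) • e j := by
  ext i
  simp [polyAct, Matrix.charmatrix_apply, Matrix.diagonal_apply, sub_smul, Finset.sum_sub_distrib,
    apply_ite (aeval T), ite_smul]

theorem polyAct_map_C (M : Matrix l m R) (e : m → V) :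
    polyAct T (M.map C) e = fun i => ∑ j, algebraMap R 𝓐 (M i j) • e j := by
  ext i
  simp [polyAct]

/-- The numerator of the transfer matrix of `x' = A x + B v`, `y = C x + J v` over the common
denominator `A.charpoly`. -/
noncomputable def transferNumerator {k : Type*} [DecidableEq m] (A : Matrix m m R)
    (B : Matrix m k R) (D : Matrix l m R) (J : Matrix l k R) : Matrix l k R[X] :=
  D.map C * A.charmatrix.adjugate * B.map C + A.charpoly • J.map C

/-- Elimination of the state: if `T x = A x + B v`, then the output `y = D x + J v` satisfies
`(A.charpoly)(T) y = N(T) v` with the numerator `N` of the transfer matrix. -/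
theorem polyAct_output {k : Type*} [Fintype k] [DecidableEq m] (A : Matrix m m R)
    (B : Matrix m k R) (D : Matrix l m R) (J : Matrix l k R) (e : m → V) (v : k → V)
    (h : polyAct T A.charmatrix e = polyAct T (B.map C) v) :
    (fun i => aeval T A.charpoly • (polyAct T (D.map C) e + polyAct T (J.map C) v) i) =
      polyAct T (transferNumerator A B D J) v := by
  rw [transferNumerator, polyAct_add, polyAct_mul, ← h, ← polyAct_mul, Matrix.mul_assoc,
    Matrix.adjugate_mul, Matrix.mul_smul, Matrix.mul_one, polyAct_smul, polyAct_smul]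
  ext i
  simp [Matrix.charpoly, smul_add]

end PolyAct

section Numerator

variable {m k l : Type*} [Fintype m] [DecidableEq m]

theorem map_ratFuncC {a b : Type*} (M : Matrix a b ℝ) :
    M.map (RatFunc.C : ℝ →+* RatFunc ℝ) = (M.map C).map (algebraMap ℝ[X] (RatFunc ℝ)) := by
  ext x y
  simp

theorem transferMatrix_apply (A : Matrix m m ℝ) (B : Matrix m k ℝ)
    (D : Matrix l m ℝ) (J : Matrix l k ℝ) (i : l) (j : k) :
    transferMatrix A B D J i j =
      algebraMap ℝ[X] (RatFunc ℝ) (transferNumerator A B D J i j) /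
        algebraMap ℝ[X] (RatFunc ℝ) A.charpoly := by
  have hP : algebraMap ℝ[X] (RatFunc ℝ) A.charpoly ≠ 0 := by
    simpa using A.charpoly_monic.ne_zero
  rw [eq_div_iff hP, transferMatrix, transferNumerator, Matrix.inv_def, ← RingHom.mapMatrix_apply,
    ← RingHom.map_det, ← RingHom.map_adjugate]
  change _ = ((D.map C * A.charmatrix.adjugate * B.map C + A.charpoly • J.map C).map
    (algebraMap ℝ[X] (RatFunc ℝ))) i j
  rw [Matrix.map_add _ (map_add _), Matrix.map_mul, Matrix.map_mul, Ring.inverse_eq_inv',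
      map_ratFuncC,
    map_ratFuncC, map_ratFuncC]
  simp only [Matrix.charpoly] at hP ⊢
  simp [Matrix.add_apply, add_mul]
  field_simp

variable {A : Matrix m m ℝ} {B : Matrix m k ℝ} {D : Matrix l m ℝ} {J : Matrix l k ℝ} {i : l} {j : k}
  {φ : ℝ[X]}

theorem num_transferMatrix_mul : (transferMatrix A B D J i j).num * A.charpoly =
    transferNumerator A B D J i j * (transferMatrix A B D J i j).denom :=
  (RatFunc.num_mul_eq_mul_denom_iff A.charpoly_monic.ne_zero).2 (transferMatrix_apply A B D J i j)

theorem dvd_transferNumerator_of_dvd_num (h : φ ∣ (transferMatrix A B D J i j).num) :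
    φ ∣ transferNumerator A B D J i j := by
  have hc := (RatFunc.isCoprime_num_denom (transferMatrix A B D J i j)).of_isCoprime_of_dvd_left h
  refine hc.dvd_of_dvd_mul_right ?_
  rw [← num_transferMatrix_mul]
  exact h.mul_right _

theorem dvd_num_of_dvd_transferNumerator (hc : IsCoprime φ A.charpoly)
    (h : φ ∣ transferNumerator A B D J i j) : φ ∣ (transferMatrix A B D J i j).num := by
  refine hc.dvd_of_dvd_mul_right ?_
  rw [num_transferMatrix_mul]
  exact h.mul_right _

end Numerator

/-! ### Asymptotics of solutions of linear differential equations -/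

/-- A scalar equation `f' = s f + g` with `Re s < 0` and an input `g` that tends to zero has only
solutions that tend to zero. -/
theorem tendsto_zero_of_hasDerivWithinAt {t₀ : ℝ} {f g : ℝ → ℂ} {s : ℂ} (hs : s.re < 0)
    (hf : ∀ t ∈ Set.Ici t₀, HasDerivWithinAt f (s * f t + g t) (Set.Ici t₀) t)
    (hg : Tendsto g atTop (𝓝 0)) : Tendsto f atTop (𝓝 0) := by
  rw [Metric.tendsto_atTop]
  intro ε hε
  set a := -s.re with ha
  have ha0 : 0 < a := by linarith
  obtain ⟨T₀, hT₀⟩ := (Metric.tendsto_atTop.1 hg) (a * (ε / 2)) (by positivity)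
  set T := max T₀ t₀
  -- the variation of constants, as a bound of the derivative of `exp (-s t) f(t)`
  set h : ℝ → ℂ := fun t => Complex.exp (-s * t) * f t with hh
  have hexp : ∀ t : ℝ, ‖Complex.exp (-s * t)‖ = Real.exp (a * t) := by
    intro t
    rw [Complex.norm_exp]
    simp [ha]
  have hd : ∀ t ∈ Set.Ici t₀,
      HasDerivWithinAt h (Complex.exp (-s * t) * g t) (Set.Ici t₀) t := by
    intro t ht
    have h1 : HasDerivAt (fun t : ℝ => Complex.exp (-s * t)) (Complex.exp (-s * t) * (-s)) t := by
      have : HasDerivAt (fun t : ℝ => -s * (t : ℂ)) (-s * 1) t :=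
        (Complex.ofRealCLM.hasDerivAt (x := t)).const_mul (-s)
      simpa using this.cexp
    refine (h1.hasDerivWithinAt.mul (hf t ht)).congr_deriv ?_
    ring
  have hbound : ∀ t, T ≤ t → ‖h t‖ ≤ ‖h T‖ + ε / 2 * Real.exp (a * t) := by
    intro t ht
    refine image_norm_le_of_norm_deriv_right_le_deriv_boundary (a := T) (b := t)
      (f' := fun t => Complex.exp (-s * t) * g t)
      (B := fun t => ‖h T‖ + ε / 2 * Real.exp (a * t))
      (B' := fun t => ε / 2 * (Real.exp (a * t) * a)) ?_ ?_ ?_ ?_ ?_ ⟨ht, le_rfl⟩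
    · intro x hx
      exact ((hd x (le_trans (le_max_right _ _) hx.1)).mono
        (fun y hy => le_trans (le_max_right _ _) hy.1)).continuousWithinAt
    · intro x hx
      exact (hd x (le_trans (le_max_right _ _) hx.1)).mono
        (fun y hy => (le_trans (le_max_right _ _) hx.1).trans hy)
    · have := Real.exp_pos (a * T)
      have : 0 ≤ ε / 2 * Real.exp (a * T) := by positivity
      linarith
    · intro x
      have : HasDerivAt (fun t : ℝ => a * t) (a * 1) x := (hasDerivAt_id x).const_mul a
      have := (this.exp.const_mul (ε / 2)).const_add ‖h T‖
      simpa using this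
    · intro x hx
      have h2 := (hT₀ x (le_trans (le_max_left _ _) hx.1)).le
      rw [dist_zero_right] at h2
      rw [norm_mul, hexp]
      nlinarith [Real.exp_pos (a * x)]
  have hlim : Tendsto (fun t : ℝ => ‖h T‖ * Real.exp (-(a * t))) atTop (𝓝 0) := by
    have : Tendsto (fun t : ℝ => Real.exp (-(a * t))) atTop (𝓝 0) :=
      Real.tendsto_exp_neg_atTop_nhds_zero.comp (tendsto_id.const_mul_atTop ha0)
    simpa using this.const_mul ‖h T‖
  obtain ⟨T₁, hT₁⟩ := (Metric.tendsto_atTop.1 hlim) (ε / 2) (by positivity)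
  refine ⟨max T T₁, fun t ht => ?_⟩
  have h1 := hbound t (le_trans (le_max_left _ _) ht)
  have h2 := hT₁ t (le_trans (le_max_right _ _) ht)
  rw [dist_zero_right, Real.norm_of_nonneg (by positivity)] at h2
  rw [hh] at h1
  simp only [norm_mul, hexp] at h1
  have h3 : Real.exp (a * t) * Real.exp (-(a * t)) = 1 := by
    rw [← Real.exp_add]; simp
  rw [dist_zero_right]
  have h4 := mul_le_mul_of_nonneg_right h1 (Real.exp_pos (-(a * t))).le
  simp only [hh, norm_mul, hexp] at h2 h4
  have e1 : Real.exp (a * t) * ‖f t‖ * Real.exp (-(a * t)) = ‖f t‖ := by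
    linear_combination ‖f t‖ * h3
  rw [e1] at h4
  nlinarith

/-- The complex signals which are smooth on `[t₀, ∞)`. They are continued by zero, so that they are
determined by their values on `[t₀, ∞)`. -/
def smoothSignals (t₀ : ℝ) : Submodule ℂ (ℝ → ℂ) where
  carrier := {f | ContDiffOn ℝ (⊤ : ℕ∞) f (Set.Ici t₀) ∧ ∀ t < t₀, f t = 0}
  add_mem' := fun hf hg => ⟨hf.1.add hg.1, fun t ht => by simp [hf.2 t ht, hg.2 t ht]⟩
  zero_mem' := ⟨contDiffOn_const, fun _ _ => rfl⟩
  smul_mem' := fun c _ hf => ⟨hf.1.const_smul c, fun t ht => by simp [hf.2 t ht]⟩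

section Signals

variable {t₀ : ℝ}

theorem derivWithin_Ici_of_lt {f : ℝ → ℂ} {t : ℝ} (ht : t < t₀) :
    derivWithin f (Set.Ici t₀) t = 0 := by
  apply derivWithin_zero_of_notMem_closure
  simpa using ht

theorem differentiableWithinAt_signal (f : smoothSignals t₀) {t : ℝ} (ht : t₀ ≤ t) :
    DifferentiableWithinAt ℝ (f : ℝ → ℂ) (Set.Ici t₀) t :=
  f.2.1.differentiableOn (by simp) t ht

/-- Differentiation of smooth signals, with the one-sided derivative at the initial time. -/
noncomputable def signalDeriv (t₀ : ℝ) : Module.End ℂ (smoothSignals t₀) where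
  toFun f := ⟨derivWithin f (Set.Ici t₀),
    ((contDiffOn_infty_iff_derivWithin (uniqueDiffOn_Ici t₀)).1 f.2.1).2,
    fun _ ht => derivWithin_Ici_of_lt ht⟩
  map_add' f g := by
    ext t
    rcases lt_or_ge t t₀ with ht | ht
    · simp [derivWithin_Ici_of_lt ht]
    · exact derivWithin_add (differentiableWithinAt_signal f ht) (differentiableWithinAt_signal g
        ht)
  map_smul' c f := by
    ext t
    rcases lt_or_ge t t₀ with ht | ht
    · simp [derivWithin_Ici_of_lt ht]
    · exact derivWithin_const_smul c (differentiableWithinAt_signal f ht)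

theorem tendsto_zero_of_aeval_prod (s : Multiset ℂ) (hs : ∀ z ∈ s, z.re < 0)
    (f : smoothSignals t₀) (hf : aeval (signalDeriv t₀) (s.map fun z => X - C z).prod f = 0) :
    Tendsto (f : ℝ → ℂ) atTop (𝓝 0) := by
  induction s using Multiset.induction_on generalizing f with
  | empty =>
    have h0 : f = 0 := by simpa using hf
    rw [h0]
    exact tendsto_const_nhds
  | cons z s ih =>
    rw [Multiset.map_cons, Multiset.prod_cons, mul_comm, map_mul, Module.End.mul_apply] at hf
    have hg := ih (fun y hy => hs y (Multiset.mem_cons_of_mem hy)) _ hf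
    refine tendsto_zero_of_hasDerivWithinAt (t₀ := t₀) (hs z (Multiset.mem_cons_self z s)) ?_ hg
    intro t ht
    refine (differentiableWithinAt_signal f ht).hasDerivWithinAt.congr_deriv ?_
    simp [signalDeriv]

/-- Signals annihilated by `p(d/dt)` tend to zero if all roots of `p` have negative real part. -/
theorem tendsto_zero_of_aeval {p : ℝ[X]} (hp : p.Monic)
    (hs : ∀ z : ℂ, aeval z p = 0 → z.re < 0)
    (f : smoothSignals t₀) (hf : aeval (signalDeriv t₀) p f = 0) :
    Tendsto (f : ℝ → ℂ) atTop (𝓝 0) := by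
  refine tendsto_zero_of_aeval_prod (p.aroots ℂ) (fun z hz => hs z (mem_aroots.1 hz).2) f ?_
  have : ((p.aroots ℂ).map fun z => X - C z).prod = p.map (algebraMap ℝ ℂ) :=
    ((IsAlgClosed.splits (p.map (algebraMap ℝ ℂ))).eq_prod_roots_of_monic
      (hp.map _)).symm
  rw [this, aeval_map_algebraMap, hf]

/-- The complex smooth signal given by a real function which is smooth on `[t₀, ∞)`. -/
noncomputable def toSignal (f : ℝ → ℝ) (hf : ContDiffOn ℝ (⊤ : ℕ∞) f (Set.Ici t₀)) :
    smoothSignals t₀ :=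
  ⟨(Set.Ici t₀).indicator fun t => (f t : ℂ),
    (Complex.ofRealCLM.contDiff.comp_contDiffOn hf).congr fun _ ht => Set.indicator_of_mem ht _,
    fun _ ht => Set.indicator_of_notMem (not_le.2 ht) _⟩

theorem toSignal_apply {f : ℝ → ℝ} {hf : ContDiffOn ℝ (⊤ : ℕ∞) f (Set.Ici t₀)} {t : ℝ}
    (ht : t₀ ≤ t) : (toSignal f hf : ℝ → ℂ) t = f t := by
  simp only [toSignal]
  exact Set.indicator_of_mem (s := Set.Ici t₀) ht _

theorem signalDeriv_toSignal_apply {f : ℝ → ℝ} {hf : ContDiffOn ℝ (⊤ : ℕ∞) f (Set.Ici t₀)} {t : ℝ}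
    (ht : t₀ ≤ t) : (signalDeriv t₀ (toSignal f hf) : ℝ → ℂ) t = derivWithin f (Set.Ici t₀) t := by
  have h1 := ((hf.differentiableOn (by simp)) t ht).hasDerivWithinAt
  have h2 : HasDerivWithinAt (fun t => (f t : ℂ)) _ (Set.Ici t₀) t := h1.ofReal_comp
  refine HasDerivWithinAt.derivWithin ?_ (uniqueDiffOn_Ici t₀ t ht)
  exact h2.congr (fun _ hy => toSignal_apply hy) (toSignal_apply ht)

theorem smoothSignals.ext_Ici {f g : smoothSignals t₀}
    (h : ∀ t, t₀ ≤ t → (f : ℝ → ℂ) t = (g : ℝ → ℂ) t) : f = g := by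
  ext t
  rcases lt_or_ge t t₀ with ht | ht
  · rw [f.2.2 t ht, g.2.2 t ht]
  · exact h t ht

theorem signalDeriv_toSignal {f : ℝ → ℝ} (hf : ContDiffOn ℝ (⊤ : ℕ∞) f (Set.Ici t₀)) :
    signalDeriv t₀ (toSignal f hf) = toSignal (derivWithin f (Set.Ici t₀))
      ((contDiffOn_infty_iff_derivWithin (uniqueDiffOn_Ici t₀)).1 hf).2 :=
  smoothSignals.ext_Ici fun t ht => by rw [signalDeriv_toSignal_apply ht, toSignal_apply ht]

theorem signalDeriv_pow_toSignal_apply (k : ℕ) {f : ℝ → ℝ}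
    {hf : ContDiffOn ℝ (⊤ : ℕ∞) f (Set.Ici t₀)} {t : ℝ} (ht : t₀ ≤ t) :
    ((signalDeriv t₀ ^ k) (toSignal f hf) : ℝ → ℂ) t =
      iteratedDerivWithin k f (Set.Ici t₀) t := by
  induction k generalizing f with
  | zero => simp [toSignal_apply ht]
  | succ k ih =>
    rw [pow_succ, Module.End.mul_apply, signalDeriv_toSignal, ih, iteratedDerivWithin_succ']

theorem contDiffOn_iteratedDerivWithin_of_add {f : ℝ → ℝ} {n k : ℕ}
    (hf : ContDiffOn ℝ ((n + k : ℕ)) f (Set.Ici t₀)) :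
    ContDiffOn ℝ n (iteratedDerivWithin k f (Set.Ici t₀)) (Set.Ici t₀) := by
  induction k generalizing n with
  | zero => simpa using hf
  | succ k ih =>
    have h := ih (n := n + 1) (by rwa [show n + 1 + k = n + (k + 1) by omega])
    rw [Nat.cast_succ, contDiffOn_succ_iff_derivWithin (uniqueDiffOn_Ici t₀)] at h
    rw [iteratedDerivWithin_succ]
    exact h.2.2

/-- Solutions of a linear differential equation with constant coefficients are smooth. -/
theorem SatisfiesModel.contDiffOn {φ : ℝ[X]} (hφ : φ.Monic) {v : ℝ → ℝ}
    (h : SatisfiesModel φ t₀ v) : ContDiffOn ℝ (⊤ : ℕ∞) v (Set.Ici t₀) := by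
  have key : ∀ k : ℕ, ContDiffOn ℝ ((φ.natDegree + k : ℕ)) v (Set.Ici t₀) := by
    intro k
    induction k with
    | zero => exact h.1
    | succ k ih =>
      have h1 : ContDiffOn ℝ ((k + 1 : ℕ))
          (iteratedDerivWithin φ.natDegree v (Set.Ici t₀)) (Set.Ici t₀) := by
        have : ContDiffOn ℝ ((k + 1 : ℕ)) (fun t => -∑ j ∈ Finset.range φ.natDegree,
            φ.coeff j * iteratedDerivWithin j v (Set.Ici t₀) t) (Set.Ici t₀) := by
          refine (ContDiffOn.sum fun j hj => contDiffOn_const.mul ?_).neg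
          refine contDiffOn_iteratedDerivWithin_of_add (ih.of_le ?_)
          have := Finset.mem_range.1 hj
          exact_mod_cast (by omega : k + 1 + j ≤ φ.natDegree + k)
        refine this.congr fun t ht => ?_
        have := h.2 t ht
        rw [Finset.sum_range_succ, hφ.coeff_natDegree] at this
        linarith
      have h2 : ∀ j ≤ φ.natDegree, ContDiffOn ℝ ((k + 1 + j : ℕ))
          (iteratedDerivWithin (φ.natDegree - j) v (Set.Ici t₀)) (Set.Ici t₀) := by
        intro j
        induction j with
        | zero => intro _; simpa using h1
        | succ j ihj =>
          intro hj
          have hsucc : (((k + 1 + (j + 1) : ℕ)) : WithTop ℕ∞) = ((k + 1 + j : ℕ)) + 1 := by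
            push_cast; ring
          rw [hsucc, contDiffOn_succ_iff_derivWithin (uniqueDiffOn_Ici t₀)]
          refine ⟨h.1.differentiableOn_iteratedDerivWithin
            (by exact_mod_cast (by omega : φ.natDegree - (j + 1) < φ.natDegree))
            (uniqueDiffOn_Ici t₀), by simp, ?_⟩
          have := ihj (by omega)
          rw [show φ.natDegree - j = φ.natDegree - (j + 1) + 1 by omega] at this
          rwa [iteratedDerivWithin_succ] at this
      have := h2 φ.natDegree le_rfl
      simp only [Nat.sub_self, iteratedDerivWithin_zero] at this
      rwa [show φ.natDegree + (k + 1) = k + 1 + φ.natDegree by omega]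
  refine contDiffOn_infty.2 fun k => (key k).of_le ?_
  exact_mod_cast Nat.le_add_left k _

/-- The model equation, as an equation in the module of signals. -/
theorem SatisfiesModel.aeval_signalDeriv {φ : ℝ[X]} (hφ : φ.Monic) {v : ℝ → ℝ}
    (h : SatisfiesModel φ t₀ v) :
    aeval (signalDeriv t₀) φ (toSignal v (h.contDiffOn hφ)) = 0 := by
  refine smoothSignals.ext_Ici fun t ht => ?_
  rw [aeval_eq_sum_range]
  have := congrArg (fun x : ℝ => (x : ℂ)) (h.2 t ht)
  simp only [Complex.ofReal_sum, Complex.ofReal_mul, Complex.ofReal_zero] at this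
  rw [LinearMap.sum_apply, Submodule.coe_sum, Finset.sum_apply]
  rw [ZeroMemClass.coe_zero, Pi.zero_apply, ← this]
  refine Finset.sum_congr rfl fun k _ => ?_
  rw [← signalDeriv_pow_toSignal_apply k ht (hf := h.contDiffOn hφ)]
  simp

theorem contDiffOn_of_linear_ode {m : Type*} [Fintype m] (A : Matrix m m ℝ) {x b : ℝ → m → ℝ}
    (hb : ContDiffOn ℝ (⊤ : ℕ∞) b (Set.Ici t₀))
    (hx : ∀ t ∈ Set.Ici t₀, HasDerivWithinAt x (A.mulVec (x t) + b t) (Set.Ici t₀) t) :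
    ContDiffOn ℝ (⊤ : ℕ∞) x (Set.Ici t₀) := by
  refine contDiffOn_infty.2 fun k => ?_
  induction k with
  | zero => exact contDiffOn_zero.2 fun t ht => (hx t ht).continuousWithinAt
  | succ k ih =>
    rw [Nat.cast_succ, contDiffOn_succ_iff_derivWithin (uniqueDiffOn_Ici t₀)]
    refine ⟨fun t ht => (hx t ht).differentiableWithinAt, by simp, ?_⟩
    refine ContDiffOn.congr ?_ fun t ht => (hx t ht).derivWithin (uniqueDiffOn_Ici t₀ t ht)
    refine ContDiffOn.add ?_ (contDiffOn_infty.1 hb k)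
    exact (A.mulVecLin.toContinuousLinearMap.contDiff.comp_contDiffOn ih :)

theorem polyAct_map_C_toSignal {a c : Type*} [Fintype c] (M : Matrix a c ℝ) (y : ℝ → c → ℝ)
    (hy : ∀ j, ContDiffOn ℝ (⊤ : ℕ∞) (fun t => y t j) (Set.Ici t₀)) (i : a) {t : ℝ} (ht : t₀ ≤ t) :
    ((polyAct (signalDeriv t₀) (M.map C) (fun j => toSignal _ (hy j)) i : smoothSignals t₀) :
      ℝ → ℂ) t =
      ((M.mulVec (y t) i : ℝ) : ℂ) := by
  rw [polyAct_map_C, Submodule.coe_sum, Finset.sum_apply]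
  simp [Matrix.mulVec, dotProduct, toSignal_apply ht]

/-- A Hurwitz system whose transfer matrix has numerators divisible by the model polynomial of its
input signals has an output that tends to zero. -/
theorem tendsto_output_zero {m k l : Type*} [Fintype m] [DecidableEq m] [Fintype k] [Finite l]
    {A : Matrix m m ℝ} {B : Matrix m k ℝ} {D : Matrix l m ℝ} {J : Matrix l k ℝ} (hA : IsHurwitz A)
    {φ : ℝ[X]} (hφ : φ.Monic) (hN : ∀ i j, φ ∣ transferNumerator A B D J i j)
    {x : ℝ → m → ℝ} {v : ℝ → k → ℝ} (hv : ∀ j, SatisfiesModel φ t₀ fun t => v t j)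
    (hx : ∀ t ∈ Set.Ici t₀,
      HasDerivWithinAt x (A.mulVec (x t) + B.mulVec (v t)) (Set.Ici t₀) t) :
    Tendsto (fun t => D.mulVec (x t) + J.mulVec (v t)) atTop (𝓝 0) := by
  have hvs := fun j => (hv j).contDiffOn hφ
  have hxs : ContDiffOn ℝ (⊤ : ℕ∞) x (Set.Ici t₀) :=
    contDiffOn_of_linear_ode A (B.mulVecLin.toContinuousLinearMap.contDiff.comp_contDiffOn
      (contDiffOn_pi.2 hvs) :) hx
  have hxs' := contDiffOn_pi.1 hxs
  set e : m → smoothSignals t₀ := fun i => toSignal _ (hxs' i)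
  set f : k → smoothSignals t₀ := fun j => toSignal _ (hvs j)
  have hode : polyAct (signalDeriv t₀) A.charmatrix e = polyAct (signalDeriv t₀) (B.map C) f := by
    ext1 i
    refine smoothSignals.ext_Ici fun t ht => ?_
    rw [polyAct_map_C_toSignal B v hvs i ht, polyAct_charmatrix]
    have h1 := polyAct_map_C_toSignal A x hxs' i ht
    rw [polyAct_map_C] at h1
    have h2 : derivWithin (fun t => x t i) (Set.Ici t₀) t =
        (A.mulVec (x t) + B.mulVec (v t)) i :=
      ((hasDerivWithinAt_pi.1 (hx t ht)) i).derivWithin (uniqueDiffOn_Ici t₀ t ht)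
    simp only [Module.End.smul_def, Submodule.coe_sub, Pi.sub_apply] at h1 ⊢
    rw [h1, signalDeriv_toSignal_apply ht, h2]
    simp
  rw [tendsto_pi_nhds]
  intro i
  have h0 := congrFun (polyAct_output (signalDeriv t₀) A B D J e f hode) i
  have h1 : polyAct (signalDeriv t₀) (transferNumerator A B D J) f i = 0 := by
    refine Finset.sum_eq_zero fun j _ => ?_
    obtain ⟨c, hc⟩ := hN i j
    rw [hc, mul_comm, map_mul, mul_smul, Module.End.smul_def (aeval _ φ),
      (hv j).aeval_signalDeriv hφ, smul_zero]
  rw [h1, Module.End.smul_def] at h0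
  have h2 := tendsto_zero_of_aeval A.charpoly_monic hA _ h0
  have h3 : Tendsto (fun t => (((D.mulVec (x t) + J.mulVec (v t)) i : ℝ) : ℂ)) atTop (𝓝 0) := by
    refine h2.congr' ?_
    filter_upwards [eventually_ge_atTop t₀] with t ht
    simp only [Pi.add_apply, Submodule.coe_add, Complex.ofReal_add]
    rw [polyAct_map_C_toSignal D x hxs' i ht, polyAct_map_C_toSignal J v hvs i ht]
  have := (Complex.continuous_re.tendsto 0).comp h3
  simpa [Function.comp_def] using this

end Signals

/-! ### Cyclic vectors and the blocks of the compensator -/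

section Cyclic

open Matrix

variable {b : Type*} [Fintype b] [DecidableEq b]

/-- A vector which is annihilated by no left eigenvector of `F` is cyclic, and the polynomials which
annihilate it are the multiples of the characteristic polynomial. -/
theorem charpoly_dvd_of_aeval_apply_eq_zero {F : Matrix b b ℝ} {g : b → ℝ}
    (hF : ∀ s : ℂ, HautusAt F (replicateCol (Fin 1) g) s) {h : ℝ[X]}
    (hh : aeval (toLin' F) h g = 0) : F.charpoly ∣ h := by
  set T := toLin' F
  set p := EuclideanDomain.gcd h F.charpoly with hp
  have hpP : p ∣ F.charpoly := EuclideanDomain.gcd_dvd_right _ _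
  have hp0 : p ≠ 0 := ne_zero_of_dvd_ne_zero F.charpoly_monic.ne_zero hpP
  have hpg : aeval T p g = 0 := by
    rw [hp, EuclideanDomain.gcd_eq_gcd_ab, map_add, mul_comm h, mul_comm F.charpoly, map_mul,
      map_mul]
    have : aeval T F.charpoly = 0 := by
      rw [← charpoly_toLin' F]
      exact LinearMap.aeval_self_charpoly T
    simp [hh, this]
  suffices hdeg : F.charpoly.natDegree ≤ p.natDegree from
    (associated_of_dvd_of_natDegree_le hpP F.charpoly_monic.ne_zero hdeg).symm.dvd.trans
      (EuclideanDomain.gcd_dvd_left _ _)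
  by_contra! hlt
  rw [charpoly_natDegree_eq_dim] at hlt
  -- the row vectors which annihilate the cyclic subspace generated by `g`
  let U : Submodule ℂ (b → ℂ) :=
    { carrier := {w | ∀ q : ℝ[X], w ⬝ᵥ (algebraMap ℝ ℂ ∘ aeval T q g) = 0}
      add_mem' := fun hx hy q => by rw [add_dotProduct, hx q, hy q, add_zero]
      zero_mem' := fun q => by simp
      smul_mem' := fun c x hx q => by rw [smul_dotProduct, hx q, smul_zero] }
  have hU : ∀ w ∈ U, w ᵥ* F.map (algebraMap ℝ ℂ) ∈ U := by
    intro w hw q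
    have e : algebraMap ℝ ℂ ∘ aeval T (X * q) g =
        F.map (algebraMap ℝ ℂ) *ᵥ (algebraMap ℝ ℂ ∘ aeval T q g) := by
      ext i
      rw [← RingHom.map_mulVec]
      simp [T]
    rw [← dotProduct_mulVec, ← e]
    exact hw _
  have hne : U ≠ ⊥ := by
    let L : (b → ℂ) →ₗ[ℂ] (Fin p.natDegree → ℂ) :=
      { toFun := fun w k => w ⬝ᵥ (algebraMap ℝ ℂ ∘ (T ^ (k : ℕ)) g)
        map_add' := fun x y => by ext; simp [add_dotProduct]
        map_smul' := fun c x => by ext; simp [smul_dotProduct] }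
    have hL : LinearMap.ker L ≠ ⊥ := LinearMap.ker_ne_bot_of_finrank_lt (by simpa using hlt)
    obtain ⟨w, hw, hw0⟩ := Submodule.exists_mem_ne_zero_of_ne_bot hL
    refine (Submodule.ne_bot_iff _).2 ⟨w, fun q => ?_, hw0⟩
    have hq : aeval T q g = aeval T (q % p) g := by
      conv_lhs => rw [← EuclideanDomain.mod_add_div q p, mul_comm p, map_add, map_mul]
      simp [hpg]
    have hdeg : (q % p).natDegree < p.natDegree ∨ q % p = 0 := by
      by_cases h0 : q % p = 0
      · exact Or.inr h0
      · exact Or.inl (natDegree_lt_natDegree h0 (EuclideanDomain.mod_lt q hp0))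
    rw [hq]
    rcases hdeg with hdeg | h0
    · rw [aeval_eq_sum_range' hdeg, LinearMap.sum_apply]
      have : algebraMap ℝ ℂ ∘ (∑ k ∈ Finset.range p.natDegree, ((q % p).coeff k • T ^ k) g) =
          ∑ k ∈ Finset.range p.natDegree, (((q % p).coeff k : ℝ) : ℂ) •
            (algebraMap ℝ ℂ ∘ (T ^ k) g) := by
        ext i
        simp
      rw [this, dotProduct_sum]
      refine Finset.sum_eq_zero fun k hk => ?_
      rw [dotProduct_smul]
      have := congrFun (LinearMap.mem_ker.1 hw) ⟨k, Finset.mem_range.1 hk⟩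
      simp only [L, LinearMap.coe_mk, AddHom.coe_mk] at this
      rw [this]
      simp
    · simp [h0]
  have : Nontrivial U := Submodule.nontrivial_iff_ne_bot.2 hne
  let S : Module.End ℂ U := (F.map (algebraMap ℝ ℂ)).vecMulLinear.restrict hU
  obtain ⟨s, hs⟩ := Module.End.exists_eigenvalue S
  obtain ⟨⟨w, hwU⟩, hw, hw0⟩ := hs.exists_hasEigenvector
  refine hw0 (Subtype.ext (hF s w ?_ ?_))
  · have := congrArg Subtype.val (Module.End.mem_eigenspace_iff.1 hw)
    simpa [S] using this
  · ext i
    have := hwU 1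
    simpa [vecMul, dotProduct] using this

/-- A polynomial solution of `(s I - F) z(s) = h(s) g` forces `h(F) g = 0`: substitute `F` for the
indeterminate. -/
theorem aeval_apply_eq_zero_of_charmatrix_mulVec {F : Matrix b b ℝ} {g : b → ℝ} {h : ℝ[X]}
    {z : b → ℝ[X]} (hz : ∀ i, (F.charmatrix *ᵥ z) i = C (g i) * h) :
    aeval (toLin' F) h g = 0 := by
  set e : b → b → ℝ := fun i => Pi.single i 1
  have h0 : polyAct (toLin' F) (Fᵀ).charmatrix e = 0 := by
    rw [polyAct_charmatrix]
    ext i x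
    simp [e, Pi.single_apply, Finset.sum_apply]
  have h1 : polyAct (toLin' F) (replicateRow (Fin 1) z * (Fᵀ).charmatrix) e = 0 := by
    rw [polyAct_mul, h0]
    ext
    simp [polyAct]
  have h2 := congrFun h1 0
  have h3 : ∀ j, (replicateRow (Fin 1) z * (Fᵀ).charmatrix) 0 j = h * C (g j) := by
    intro j
    rw [mul_comm, ← hz j, charmatrix_transpose]
    simp [Matrix.mul_apply, mulVec, dotProduct, mul_comm]
  have h4 : ∑ i, g i • e i = g := by
    ext x
    simp [e, Pi.single_apply, Finset.sum_apply]
  rw [polyAct] at h2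
  simp only [h3] at h2
  rw [← h4, map_sum]
  simpa using h2

end Cyclic

section Augmented

open Matrix

variable {n r d p β : ℕ}

theorem closedLoop_eq {κ : Type*} (A : Matrix (Fin n) (Fin n) ℝ) (B : Matrix (Fin n) (Fin r) ℝ)
    (D : Matrix (Fin d) (Fin n) ℝ) (F : Matrix κ κ ℝ) (Γ : Matrix κ (Fin d) ℝ)
    (K₁ : Matrix (Fin r) (Fin n) ℝ) (K₂ : Matrix (Fin r) κ ℝ) :
    closedLoop A B D F Γ K₁ K₂ = augmentedA A D F Γ + augmentedB κ B * fromCols K₁ K₂ := by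
  simp [closedLoop, augmentedA, augmentedB, fromBlocks_add]

variable {A : Matrix (Fin n) (Fin n) ℝ} {B : Matrix (Fin n) (Fin r) ℝ}
  {D : Matrix (Fin d) (Fin n) ℝ} {F : Fin d → Matrix (Fin β) (Fin β) ℝ} {γ : Fin d → Fin β → ℝ}

/-- The Hautus condition for the augmented pair, with the row vector split into the part `w` of the
plant and the parts `y i` of the blocks of the compensator. -/
theorem hautusAt_augmented_iff {s : ℂ} :
    HautusAt (augmentedA A D (blockDiagonal F) (servoGamma γ)) (augmentedB (Fin β × Fin d) B) s ↔
      ∀ (w : Fin n → ℂ) (y : Fin d → Fin β → ℂ),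
        w ᵥ* A.map (algebraMap ℝ ℂ) +
          (fun i => y i ⬝ᵥ (algebraMap ℝ ℂ ∘ γ i)) ᵥ* D.map (algebraMap ℝ ℂ) = s • w →
        (∀ i, y i ᵥ* (F i).map (algebraMap ℝ ℂ) = s • y i) →
        w ᵥ* B.map (algebraMap ℝ ℂ) = 0 → w = 0 ∧ y = 0 := by
  have key : ∀ (w : Fin n → ℂ) (y : Fin d → Fin β → ℂ),
      ((Sum.elim w fun a => y a.2 a.1) ᵥ*
        (augmentedA A D (blockDiagonal F) (servoGamma γ)).map (algebraMap ℝ ℂ) =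
          s • (Sum.elim w fun a => y a.2 a.1) ↔
        w ᵥ* A.map (algebraMap ℝ ℂ) +
          (fun i => y i ⬝ᵥ (algebraMap ℝ ℂ ∘ γ i)) ᵥ* D.map (algebraMap ℝ ℂ) = s • w ∧
        ∀ i, y i ᵥ* (F i).map (algebraMap ℝ ℂ) = s • y i) ∧
      ((Sum.elim w fun a => y a.2 a.1) ᵥ*
        (augmentedB (Fin β × Fin d) B).map (algebraMap ℝ ℂ) = w ᵥ* B.map (algebraMap ℝ ℂ)) := by
    intro w y
    refine ⟨⟨fun h => ⟨funext fun x => ?_, fun i => funext fun a => ?_⟩, fun h => funext fun z =>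
        ?_⟩,
      ?_⟩
    · have := congrFun h (Sum.inl x)
      refine Eq.trans ?_ this
      simp [vecMul, dotProduct, augmentedA, servoGamma, Matrix.mul_apply,
          Fintype.sum_prod_type_right,
        Finset.sum_mul, mul_assoc]
    · have := congrFun h (Sum.inr (a, i))
      simpa [vecMul, dotProduct, augmentedA, blockDiagonal_apply, Fintype.sum_prod_type_right,
        apply_ite] using this
    · rcases z with x | ⟨a, i⟩
      · have := congrFun h.1 x
        simp only [Pi.smul_apply, Sum.elim_inl] at this ⊢
        rw [← this]
        simp [vecMul, dotProduct, augmentedA, servoGamma, Matrix.mul_apply,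
          Fintype.sum_prod_type_right, Finset.sum_mul, mul_assoc]
      · have := congrFun (h.2 i) a
        simpa [vecMul, dotProduct, augmentedA, blockDiagonal_apply, Fintype.sum_prod_type_right,
          apply_ite] using this
    · ext j
      simp [vecMul, dotProduct, augmentedB]
  constructor
  · intro h w y h1 h2 h3
    have := h _ ((key w y).1.2 ⟨h1, h2⟩) ((key w y).2.trans h3)
    exact ⟨funext fun x => congrFun this (Sum.inl x),
      funext fun i => funext fun a => congrFun this (Sum.inr (a, i))⟩
  · intro h z h1 h2
    have hz : z = Sum.elim (fun x => z (Sum.inl x)) fun a => (fun i a => z (Sum.inr (a, i))) a.2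
        a.1 := by
      ext (x | x) <;> rfl
    rw [hz] at h1 h2
    obtain ⟨h3, h4⟩ := (key _ fun i a => z (Sum.inr (a, i))).1.1 h1
    obtain ⟨h5, h6⟩ := h _ _ h3 h4 ((key _ fun i a => z (Sum.inr (a, i))).2.symm.trans h2)
    ext (x | x)
    · exact congrFun h5 x
    · exact congrFun (congrFun h6 x.2) x.1

theorem HautusAt.block {s : ℂ}
    (h : HautusAt (augmentedA A D (blockDiagonal F) (servoGamma γ)) (augmentedB (Fin β × Fin d) B)
        s)
    (i : Fin d) : HautusAt (F i) (replicateCol (Fin 1) (γ i)) s := by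
  intro v hv hg
  have hg' : v ⬝ᵥ (algebraMap ℝ ℂ ∘ γ i) = 0 := by simpa [vecMul, dotProduct] using congrFun hg 0
  have := hautusAt_augmented_iff.1 h 0 (Pi.single i v) ?_ ?_ ?_
  · simpa using congrFun this.2 i
  · have : (fun j => (Pi.single i v : Fin d → Fin β → ℂ) j ⬝ᵥ (algebraMap ℝ ℂ ∘ γ j)) = 0 := by
      ext j
      by_cases hj : j = i
      · subst hj; simpa using hg'
      · simp [Pi.single_eq_of_ne hj]
    rw [this]
    simp
  · intro j
    by_cases hj : j = i
    · subst hj; simpa using hv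
    · simp [Pi.single_eq_of_ne hj]
  · simp

theorem HautusAt.plant {s : ℂ}
    (h : HautusAt (augmentedA A D (blockDiagonal F) (servoGamma γ)) (augmentedB (Fin β × Fin d) B)
        s) :
    HautusAt A B s := by
  intro w hw hB
  refine (hautusAt_augmented_iff.1 h w 0 ?_ (fun i => by simp) hB).1
  rw [hw]
  have : (fun i => (0 : Fin d → Fin β → ℂ) i ⬝ᵥ (algebraMap ℝ ℂ ∘ γ i)) = 0 := by ext; simp
  rw [this]
  simp

/-- At a complex number which is no eigenvalue of some closed loop, the pair satisfies the Hautus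
condition. -/
theorem HautusAt.of_charpoly_ne_zero {m k : Type*} [Fintype m] [DecidableEq m] [Fintype k]
    {A : Matrix m m ℝ} {B : Matrix m k ℝ} {K : Matrix k m ℝ} {s : ℂ}
    (h : aeval s (A + B * K).charpoly ≠ 0) : HautusAt A B s := by
  intro w hw hB
  by_contra h0
  refine h ((aeval_charpoly_eq_zero_iff _ _).2 ⟨w, h0, ?_⟩)
  rw [Matrix.map_add _ (map_add _), Matrix.map_mul, vecMul_add, ← vecMul_vecMul, hB]
  simpa using hw

/-- Each block of the closed loop with an internal model forces the model polynomial into the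
numerators of the corresponding component of the error. -/
theorem charpoly_dvd_errorNumerator {E : Matrix (Fin n) (Fin p) ℝ} {K₁ : Matrix (Fin r) (Fin n) ℝ}
    {K₂ : Matrix (Fin r) (Fin β × Fin d) ℝ} {i : Fin d}
    (hi : ∀ s : ℂ, HautusAt (F i) (replicateCol (Fin 1) (γ i)) s) (j : Fin d ⊕ Fin p) :
    (F i).charpoly ∣ transferNumerator (closedLoop A B D (blockDiagonal F) (servoGamma γ) K₁ K₂)
      (fromBlocks 0 E (-servoGamma γ) 0 : Matrix (Fin n ⊕ (Fin β × Fin d)) (Fin d ⊕ Fin p) ℝ)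
      (fromCols D 0 : Matrix (Fin d) (Fin n ⊕ (Fin β × Fin d)) ℝ)
      (fromCols (-1) 0 : Matrix (Fin d) (Fin d ⊕ Fin p) ℝ) i j := by
  set M := closedLoop A B D (blockDiagonal F) (servoGamma γ) K₁ K₂ with hM
  set G : Matrix (Fin n ⊕ (Fin β × Fin d)) (Fin d ⊕ Fin p) ℝ :=
    fromBlocks 0 E (-servoGamma γ) 0 with hG
  set Z := M.charmatrix.adjugate * G.map C with hZ
  refine charpoly_dvd_of_aeval_apply_eq_zero hi (aeval_apply_eq_zero_of_charmatrix_mulVec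
    (z := fun a => Z (Sum.inr (a, i)) j) fun a => ?_)
  have h1 : M.charmatrix * Z = M.charpoly • G.map C := by
    rw [hZ, ← Matrix.mul_assoc, mul_adjugate, smul_mul, Matrix.one_mul, Matrix.charpoly]
  have h2 := congrFun (congrFun h1 (Sum.inr (a, i))) j
  rw [transferNumerator, Matrix.mul_assoc, ← hZ]
  have h3 : ∀ x : Fin n, M (Sum.inr (a, i)) (Sum.inl x) = γ i a * D i x := by
    intro x
    simp [hM, closedLoop, servoGamma, Matrix.mul_apply]
  have h4 : ∀ x : Fin β × Fin d, M (Sum.inr (a, i)) (Sum.inr x) = if i = x.2 then F i a x.1 else 0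
      := by
    intro x
    simp [hM, closedLoop, blockDiagonal_apply]
  have h5 : G (Sum.inr (a, i)) j = γ i a * (fromCols (-1) 0 : Matrix (Fin d) (Fin d ⊕ Fin p) ℝ) i j
      := by
    rcases j with j | j
    · rcases eq_or_ne i j with rfl | hij
      · simp [hG, servoGamma]
      · simp [hG, servoGamma, hij]
    · simp [hG]
  simp only [Matrix.mul_apply, charmatrix_apply, diagonal_apply, Fintype.sum_sum_type, sub_mul,
    Finset.sum_sub_distrib, h3, h4, Fintype.sum_prod_type_right, Matrix.smul_apply,
        Matrix.map_apply,
    h5, smul_eq_mul] at h2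
  simp only [mulVec, dotProduct, charmatrix_apply, diagonal_apply, sub_mul, Finset.sum_sub_distrib,
    Matrix.add_apply, Matrix.mul_apply, Fintype.sum_sum_type, Matrix.smul_apply, Matrix.map_apply,
    smul_eq_mul, fromCols_apply_inl, fromCols_apply_inr]
  simp [apply_ite C, ite_mul, Finset.sum_ite_eq, Prod.ext_iff, ite_and, mul_assoc, ←
      Finset.mul_sum] at h2 ⊢
  linear_combination h2

end Augmented

/-! ### Right coprime factorizations -/

section Coprime

open Matrix

theorem exists_leftInverse_subtype {R V : Type*} [CommRing R] [AddCommGroup V] [Module R V]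
    (U : Submodule R V) [Module.Projective R (V ⧸ U)] : ∃ π : V →ₗ[R] U, ∀ u : U, π u = u := by
  obtain ⟨σ, hσ⟩ := Module.projective_lifting_property U.mkQ LinearMap.id U.mkQ_surjective
  have hmem : ∀ v : V, (LinearMap.id - σ ∘ₗ U.mkQ : V →ₗ[R] V) v ∈ U := fun v => by
    rw [← Submodule.Quotient.mk_eq_zero]
    have := LinearMap.congr_fun hσ (U.mkQ v)
    simpa [sub_eq_zero] using this.symm
  refine ⟨(LinearMap.id - σ ∘ₗ U.mkQ).codRestrict U hmem, fun u => Subtype.ext ?_⟩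
  have : U.mkQ (u : V) = 0 := by simp
  rw [LinearMap.codRestrict_apply, LinearMap.sub_apply, LinearMap.comp_apply, this]
  simp

variable {k l : Type*} [Fintype k]

theorem algebraMap_comp_add {a : Type*} (x y : a → ℝ[X]) :
    algebraMap ℝ[X] (RatFunc ℝ) ∘ (x + y) =
      algebraMap ℝ[X] (RatFunc ℝ) ∘ x + algebraMap ℝ[X] (RatFunc ℝ) ∘ y := by
  ext
  simp

theorem algebraMap_comp_smul {a : Type*} (c : ℝ[X]) (x : a → ℝ[X]) :
    algebraMap ℝ[X] (RatFunc ℝ) ∘ (c • x) =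
      algebraMap ℝ[X] (RatFunc ℝ) c • (algebraMap ℝ[X] (RatFunc ℝ) ∘ x) := by
  ext
  simp

/-- The graph of the rational matrix `G` over the polynomial vectors. -/
noncomputable def polyGraph (G : Matrix l k (RatFunc ℝ)) :
    Submodule ℝ[X] ((l → ℝ[X]) × (k → ℝ[X])) where
  carrier := {v | algebraMap ℝ[X] (RatFunc ℝ) ∘ v.1 = G *ᵥ (algebraMap ℝ[X] (RatFunc ℝ) ∘ v.2)}
  add_mem' := by
    intro a b ha hb
    simp only [Set.mem_ofPred_eq, Prod.fst_add, Prod.snd_add] at ha hb ⊢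
    rw [algebraMap_comp_add, algebraMap_comp_add, mulVec_add, ha, hb]
  zero_mem' := by ext; simp [mulVec, dotProduct]
  smul_mem' := by
    intro c x hx
    simp only [Set.mem_ofPred_eq, Prod.smul_fst, Prod.smul_snd] at hx ⊢
    rw [algebraMap_comp_smul, algebraMap_comp_smul, mulVec_smul, ← hx]

theorem mem_polyGraph {G : Matrix l k (RatFunc ℝ)} {v : (l → ℝ[X]) × (k → ℝ[X])} :
    v ∈ polyGraph G ↔
      algebraMap ℝ[X] (RatFunc ℝ) ∘ v.1 = G *ᵥ (algebraMap ℝ[X] (RatFunc ℝ) ∘ v.2) := Iff.rfl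

theorem isTorsionFree_quotient_polyGraph (G : Matrix l k (RatFunc ℝ)) :
    Module.IsTorsionFree ℝ[X] (((l → ℝ[X]) × (k → ℝ[X])) ⧸ polyGraph G) := by
  refine Module.IsTorsionFree.of_smul_eq_zero fun c x h => ?_
  induction x using Submodule.Quotient.induction_on with
  | _ v =>
    by_cases hc : c = 0
    · exact Or.inl hc
    right
    rw [← Submodule.Quotient.mk_smul, Submodule.Quotient.mk_eq_zero, mem_polyGraph] at h
    rw [Submodule.Quotient.mk_eq_zero, mem_polyGraph]
    have hc' : algebraMap ℝ[X] (RatFunc ℝ) c ≠ 0 := by simpa using hc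
    rw [Prod.smul_snd, algebraMap_comp_smul, mulVec_smul] at h
    ext i
    have := congrFun h i
    simp only [Function.comp_apply, Prod.smul_fst, Pi.smul_apply, smul_eq_mul, map_mul] at this
    exact mul_left_cancel₀ hc' this

theorem eq_zero_of_mem_polyGraph {G : Matrix l k (RatFunc ℝ)} {v : (l → ℝ[X]) × (k → ℝ[X])}
    (h : v ∈ polyGraph G) (h2 : v.2 = 0) : v = 0 := by
  refine Prod.ext (funext fun i => ?_) h2
  have := congrFun (mem_polyGraph.1 h) i
  rw [h2] at this
  simpa [mulVec, dotProduct] using this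

variable [DecidableEq k] [Fintype l] [DecidableEq l]

/-- A rational matrix has a right coprime factorization. The columns of `N` and `M` form a basis of
the graph of `G` over the polynomial vectors; they are coprime since the graph is a direct summand.
-/
theorem exists_isRightCoprimeFactorization (G : Matrix l k (RatFunc ℝ)) (N₀ : Matrix l k ℝ[X])
    {c : ℝ[X]} (hc : c ≠ 0)
    (hG : ∀ i j, algebraMap ℝ[X] (RatFunc ℝ) c * G i j = algebraMap ℝ[X] (RatFunc ℝ) (N₀ i j)) :
    ∃ N M, IsRightCoprimeFactorization G N M := by
  have := isTorsionFree_quotient_polyGraph G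
  have hfree : Module.Free ℝ[X] (((l → ℝ[X]) × (k → ℝ[X])) ⧸ polyGraph G) :=
    Module.free_of_finite_type_torsion_free'
  obtain ⟨π, hπ⟩ := exists_leftInverse_subtype (polyGraph G)
  have hrank : Module.finrank ℝ[X] (polyGraph G) = Fintype.card k := by
    apply le_antisymm
    · have := LinearMap.finrank_le_finrank_of_injective
        (f := LinearMap.snd ℝ[X] (l → ℝ[X]) (k → ℝ[X]) ∘ₗ (polyGraph G).subtype) ?_
      · simpa using this
      · refine (injective_iff_map_eq_zero _).2 fun v hv => Subtype.ext ?_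
        exact eq_zero_of_mem_polyGraph v.2 hv
    · let f : (k → ℝ[X]) →ₗ[ℝ[X]] polyGraph G :=
        (LinearMap.prod N₀.mulVecLin (c • LinearMap.id)).codRestrict (polyGraph G) fun v => by
          rw [mem_polyGraph]
          ext i
          simp [mulVec, dotProduct, ← hG]
          refine Finset.sum_congr rfl fun j _ => ?_
          ring
      have := LinearMap.finrank_le_finrank_of_injective (f := f) ?_
      · simpa using this
      · refine (injective_iff_map_eq_zero _).2 fun v hv => ?_
        have h2 := congrArg (fun z : polyGraph G => (z : (l → ℝ[X]) × (k → ℝ[X])).2) hv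
        have h3 : c • v = 0 := h2
        exact (smul_eq_zero.1 h3).resolve_left hc
  let b : Module.Basis k ℝ[X] (polyGraph G) :=
    (Module.finBasisOfFinrankEq ℝ[X] (polyGraph G) hrank).reindex (Fintype.equivFin k).symm
  let N : Matrix l k ℝ[X] := Matrix.of fun i j => (b j : (l → ℝ[X]) × (k → ℝ[X])).1 i
  let M : Matrix k k ℝ[X] := Matrix.of fun i j => (b j : (l → ℝ[X]) × (k → ℝ[X])).2 i
  have hdet : M.det ≠ 0 := by
    intro h0
    obtain ⟨v, hv0, hv⟩ := exists_mulVec_eq_zero_iff.2 h0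
    have h1 : (∑ j, v j • b j : polyGraph G) = 0 := by
      refine Subtype.ext (eq_zero_of_mem_polyGraph (Subtype.mem _) ?_)
      ext i : 1
      have := congrFun hv i
      simpa [M, mulVec, dotProduct, mul_comm, Prod.snd_sum] using this
    exact hv0 (funext (Fintype.linearIndependent_iff.1 b.linearIndependent v h1))
  have hGM : N.map (algebraMap ℝ[X] (RatFunc ℝ)) = G * M.map (algebraMap ℝ[X] (RatFunc ℝ)) := by
    ext i j
    have := congrFun (mem_polyGraph.1 (b j).2) i
    simpa [N, M, mulVec, dotProduct, Matrix.mul_apply] using this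
  have hunit : IsUnit (M.map (algebraMap ℝ[X] (RatFunc ℝ))).det := by
    rw [← RingHom.mapMatrix_apply, ← RingHom.map_det]
    simpa using hdet
  refine ⟨N, M, hdet, ?_, Matrix.of fun i j => b.repr (π (Pi.single j 1, 0)) i,
    Matrix.of fun i j => b.repr (π (0, Pi.single j 1)) i, ?_⟩
  · rw [hGM, Matrix.mul_assoc, Matrix.mul_nonsing_inv _ hunit, Matrix.mul_one]
  · ext i j
    have h1 : (b j : (l → ℝ[X]) × (k → ℝ[X])) =
        ∑ x, N x j • ((Pi.single x 1 : l → ℝ[X]), (0 : k → ℝ[X])) +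
          ∑ x, M x j • ((0 : l → ℝ[X]), (Pi.single x 1 : k → ℝ[X])) := by
      refine Prod.ext ?_ ?_ <;> ext1 y
      · simp [Prod.fst_sum, Finset.sum_apply, Pi.single_apply, N]
      · simp [Prod.snd_sum, Finset.sum_apply, Pi.single_apply, M]
    have h2 := congrArg (fun z => b.repr (π z) i) h1
    simp only [hπ, map_add, map_sum, map_smul, b.repr_self, Finsupp.add_apply,
        Finsupp.coe_finsetSum,
      Finset.sum_apply, Finsupp.smul_apply, smul_eq_mul] at h2
    rw [Matrix.add_apply, Matrix.mul_apply, Matrix.mul_apply, Matrix.one_apply]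
    simp only [Matrix.of_apply, mul_comm _ (N _ _), mul_comm _ (M _ _)]
    rw [← h2, Finsupp.single_apply]
    simp [eq_comm]

end Coprime

/-! ### Transmission zeros and the system matrix -/

section Zeros

open Matrix

variable {m k l : Type*} [Fintype m] [DecidableEq m] {A : Matrix m m ℝ} {B : Matrix m k ℝ}
  {D : Matrix l m ℝ}

theorem map_map_C_aeval {a b : Type*} (Q : Matrix a b ℝ) (s : ℂ) :
    (Q.map C).map (aeval s) = Q.map (algebraMap ℝ ℂ) := by
  ext
  simp

theorem map_charmatrix_aeval (A : Matrix m m ℝ) (s : ℂ) :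
    A.charmatrix.map (aeval s) = s • 1 - A.map (algebraMap ℝ ℂ) := by
  ext i j
  by_cases h : i = j <;> simp [h]

theorem rank_eq_card_iff {K k l : Type*} [Field K] [Fintype k] [Fintype l] (Q : Matrix l k K) :
    Q.rank = Fintype.card l ↔ ∀ η : l → K, η ᵥ* Q = 0 → η = 0 := by
  rw [rank_eq_finrank_span_row, eq_comm, ← Set.finrank, ←
      linearIndependent_iff_card_eq_finrank_span,
    ← vecMul_injective_iff]
  exact injective_iff_map_eq_zero Q.vecMulLinear

/-- A space of row vectors which is invariant under `A` and contains the rows of `D` is everything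
if `(A, D)` is observable: the observability matrix has full rank. -/
theorem IsObservablePair.eq_top (h : IsObservablePair A D) (U : Submodule ℝ (m → ℝ))
    (hD : ∀ i, D i ∈ U) (hA : ∀ v ∈ U, v ᵥ* A ∈ U) : U = ⊤ := by
  by_contra hU
  obtain ⟨f, hf0, hf⟩ := Submodule.exists_le_ker_of_lt_top U (lt_top_iff_ne_top.2 hU)
  have hfv : ∀ v, f v = v ⬝ᵥ fun i => f (Pi.single i 1) := by
    intro v
    conv_lhs => rw [pi_eq_sum_univ' v]
    simp [dotProduct, Pi.single]
  have hpow : ∀ (j : ℕ) i, (D * A ^ j) i ∈ U := by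
    intro j
    induction j with
    | zero => simpa using hD
    | succ j ih =>
      intro i
      have := hA _ (ih i)
      rwa [show (D * A ^ j) i ᵥ* A = (D * A ^ (j + 1)) i by
        rw [pow_succ, ← Matrix.mul_assoc]; rfl] at this
  have h0 := h (fun i => f (Pi.single i 1)) fun j => funext fun i => by
    have := hf (hpow j i)
    rw [LinearMap.mem_ker, hfv] at this
    exact this
  refine hf0 (LinearMap.ext fun v => ?_)
  rw [hfv, h0]
  simp

variable [Fintype k] [DecidableEq k] [Fintype l] [DecidableEq l]

/-- For an observable pair the factorization `D (s I - A)⁻¹ B = N M⁻¹` lifts to a polynomial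
solution of `(s I - A) X = B M`, `D X = N`. -/
theorem IsRightCoprimeFactorization.exists_state (h : IsObservablePair A D) {N : Matrix l k ℝ[X]}
    {M : Matrix k k ℝ[X]} (hNM : IsRightCoprimeFactorization (transferMatrix A B D 0) N M) :
    ∃ Z : Matrix m k ℝ[X], A.charmatrix * Z = B.map C * M ∧ D.map C * Z = N := by
  have hP := A.charpoly_monic.ne_zero
  set Y := A.charmatrix.adjugate * (B.map C * M) with hY
  have hY1 : A.charmatrix * Y = A.charpoly • (B.map C * M) := by
    rw [hY, ← Matrix.mul_assoc, mul_adjugate, smul_mul, Matrix.one_mul, Matrix.charpoly]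
  have hY2 : D.map C * Y = A.charpoly • N := by
    obtain ⟨hdet, hG, -⟩ := hNM
    have hunit : IsUnit (M.map (algebraMap ℝ[X] (RatFunc ℝ))).det := by
      rw [← RingHom.mapMatrix_apply, ← RingHom.map_det]
      simpa using hdet
    have h1 : transferMatrix A B D 0 * M.map (algebraMap ℝ[X] (RatFunc ℝ)) =
        N.map (algebraMap ℝ[X] (RatFunc ℝ)) := by
      rw [hG, Matrix.mul_assoc, Matrix.nonsing_inv_mul _ hunit, Matrix.mul_one]
    have h2 : (transferNumerator A B D 0).map (algebraMap ℝ[X] (RatFunc ℝ)) =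
        algebraMap ℝ[X] (RatFunc ℝ) A.charpoly • transferMatrix A B D 0 := by
      ext i j
      have hP' : algebraMap ℝ[X] (RatFunc ℝ) A.charpoly ≠ 0 := by simpa using hP
      rw [Matrix.smul_apply, transferMatrix_apply, smul_eq_mul, mul_div_cancel₀ _ hP',
          Matrix.map_apply]
    have h3 : transferNumerator A B D 0 * M = A.charpoly • N := by
      refine Matrix.map_injective (RatFunc.algebraMap_injective ℝ) ?_
      change (transferNumerator A B D 0 * M).map _ = (A.charpoly • N).map _
      rw [Matrix.map_mul, h2, smul_mul, h1]
      ext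
      simp
    rw [← h3, transferNumerator, hY]
    simp [Matrix.mul_assoc]
  -- the row vectors `v` for which `v Y` is divisible by the characteristic polynomial
  let U : Submodule ℝ (m → ℝ) :=
    { carrier := {v | ∀ j, A.charpoly ∣ ∑ x, C (v x) * Y x j}
      add_mem' := fun {a b} ha hb j => by
        simpa [add_mul, Finset.sum_add_distrib] using dvd_add (ha j) (hb j)
      zero_mem' := fun j => by simp
      smul_mem' := fun c x hx j => by
        simpa [mul_assoc, ← Finset.mul_sum] using (hx j).mul_left (C c) }
  have hU : U = ⊤ := by
    refine h.eq_top U (fun i j => ?_) fun v hv j => ?_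
    · have := congrFun (congrFun hY2 i) j
      rw [Matrix.mul_apply] at this
      simp only [Matrix.map_apply] at this
      rw [this]
      exact Dvd.intro _ rfl
    · have h1 : ∀ x, ∑ y, C (A x y) * Y y j = X * Y x j - A.charpoly * (B.map C * M) x j := by
        intro x
        have := congrFun (congrFun hY1 x) j
        simp [Matrix.mul_apply, charmatrix_apply, diagonal_apply, sub_mul,
          Finset.sum_sub_distrib] at this
        rw [Matrix.mul_apply]
        simp only [Matrix.map_apply]
        linear_combination -this
      have h2 : ∑ y, C ((v ᵥ* A) y) * Y y j = X * (∑ x, C (v x) * Y x j) -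
          A.charpoly * ∑ x, C (v x) * (B.map C * M) x j := by
        have : ∑ y, C ((v ᵥ* A) y) * Y y j = ∑ x, C (v x) * ∑ y, C (A x y) * Y y j := by
          simp only [vecMul, dotProduct, map_sum, Finset.sum_mul, Finset.mul_sum, map_mul,
              mul_assoc]
          exact Finset.sum_comm
        rw [this]
        simp only [h1, mul_sub, Finset.sum_sub_distrib, Finset.mul_sum]
        congr 1 <;> refine Finset.sum_congr rfl fun x _ => by ring
      rw [h2]
      exact dvd_sub ((hv j).mul_left _) (Dvd.intro _ rfl)
  have hdvd : ∀ x j, A.charpoly ∣ Y x j := by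
    intro x j
    have : Pi.single x 1 ∈ U := hU ▸ Submodule.mem_top
    have := this j
    simpa [Pi.single_apply, apply_ite C, ite_mul] using this
  choose Z hZ using hdvd
  have hYZ : Y = A.charpoly • (Matrix.of Z) := by
    ext1 x j
    simp [hZ]
  refine ⟨Matrix.of Z, smul_right_injective _ hP ?_, smul_right_injective _ hP ?_⟩
  · change A.charpoly • _ = A.charpoly • _
    rw [← hY1, hYZ, Matrix.mul_smul]
  · change A.charpoly • _ = A.charpoly • _
    rw [← hY2, hYZ, Matrix.mul_smul]

/-- The left kernel of the numerator `N(s)` is the projection of the left kernel of the system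
matrix: `η N(s) = 0` if and only if `w (s I - A) = η D` and `w B = 0` for some `w`. -/
theorem vecMul_numerator_eq_zero_iff (hobs : IsObservablePair A D) {N : Matrix l k ℝ[X]}
    {M : Matrix k k ℝ[X]} (hNM : IsRightCoprimeFactorization (transferMatrix A B D 0) N M) {s : ℂ}
    (hs : HautusAt A B s) (η : l → ℂ) :
    η ᵥ* N.map (aeval s) = 0 ↔ ∃ w : m → ℂ,
      w ᵥ* A.map (algebraMap ℝ ℂ) + η ᵥ* D.map (algebraMap ℝ ℂ) = s • w ∧
      w ᵥ* B.map (algebraMap ℝ ℂ) = 0 := by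
  obtain ⟨Z, hZ1, hZ2⟩ := hNM.exists_state hobs
  obtain ⟨-, -, X', Y', hXY⟩ := hNM
  have e1 : (s • 1 - A.map (algebraMap ℝ ℂ)) * Z.map (aeval s) =
      B.map (algebraMap ℝ ℂ) * M.map (aeval s) := by
    rw [← map_charmatrix_aeval, ← map_map_C_aeval B s, ← Matrix.map_mul, hZ1, Matrix.map_mul]
  have e2 : D.map (algebraMap ℝ ℂ) * Z.map (aeval s) = N.map (aeval s) := by
    rw [← map_map_C_aeval D s, ← Matrix.map_mul, hZ2]
  have e3 : X'.map (aeval s) * N.map (aeval s) + Y'.map (aeval s) * M.map (aeval s) = 1 := by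
    rw [← Matrix.map_mul, ← Matrix.map_mul, ← Matrix.map_add _ (map_add _), hXY]
    exact Matrix.map_one _ (map_zero _) (map_one _)
  constructor
  · intro hη
    -- the rows of `[s I - A, -B]` span the left kernel of `[Z(s); M(s)]`, by their dimensions
    let S : Matrix m (m ⊕ k) ℂ :=
      fromCols (s • 1 - A.map (algebraMap ℝ ℂ)) (-B.map (algebraMap ℝ ℂ))
    let Q : Matrix (m ⊕ k) k ℂ := fromRows (Z.map (aeval s)) (M.map (aeval s))
    have hSQ : S * Q = 0 := by
      simp only [S, Q]
      rw [fromCols_mul_fromRows, e1, Matrix.neg_mul, add_neg_cancel]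
    have hLQ : fromCols (X'.map (aeval s) * D.map (algebraMap ℝ ℂ)) (Y'.map (aeval s)) * Q = 1 := by
      simp only [Q]
      rw [fromCols_mul_fromRows, Matrix.mul_assoc, e2, e3]
    have hSinj : LinearMap.ker S.vecMulLinear = ⊥ := by
      rw [LinearMap.ker_eq_bot']
      intro w hw
      have hw' : w ᵥ* S = 0 := hw
      rw [vecMul_fromCols] at hw'
      refine hs w (funext fun i => ?_) (funext fun i => ?_)
      · have := congrFun hw' (Sum.inl i)
        simp [vecMul_sub, vecMul_smul, sub_eq_zero] at this
        simpa using this.symm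
      · have := congrFun hw' (Sum.inr i)
        simpa [vecMul_neg] using this
    have hQsurj : LinearMap.range Q.vecMulLinear = ⊤ := by
      rw [LinearMap.range_eq_top]
      intro c
      refine ⟨c ᵥ* fromCols (X'.map (aeval s) * D.map (algebraMap ℝ ℂ)) (Y'.map (aeval s)), ?_⟩
      rw [vecMulLinear_apply, vecMul_vecMul, hLQ, vecMul_one]
    have hle : LinearMap.range S.vecMulLinear ≤ LinearMap.ker Q.vecMulLinear := by
      rintro _ ⟨w, rfl⟩
      rw [LinearMap.mem_ker, vecMulLinear_apply, vecMulLinear_apply, vecMul_vecMul, hSQ,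
          vecMul_zero]
    have heq : LinearMap.range S.vecMulLinear = LinearMap.ker Q.vecMulLinear := by
      refine Submodule.eq_of_le_of_finrank_eq hle ?_
      have h1 := LinearMap.finrank_range_add_finrank_ker S.vecMulLinear
      have h2 := LinearMap.finrank_range_add_finrank_ker Q.vecMulLinear
      rw [hSinj, finrank_bot] at h1
      rw [hQsurj, finrank_top] at h2
      simp only [Module.finrank_fintype_fun_eq_card, Fintype.card_sum] at h1 h2
      omega
    have hmem : Sum.elim (η ᵥ* D.map (algebraMap ℝ ℂ)) (0 : k → ℂ) ∈
        LinearMap.ker Q.vecMulLinear := by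
      rw [LinearMap.mem_ker, vecMulLinear_apply]
      simp only [Q]
      rw [sumElim_vecMul_fromRows, vecMul_vecMul, e2, hη]
      simp
    rw [← heq] at hmem
    obtain ⟨w, hw⟩ := hmem
    have hw' : w ᵥ* S = _ := hw
    rw [vecMul_fromCols] at hw'
    refine ⟨w, funext fun i => ?_, funext fun i => ?_⟩
    · have := congrFun hw' (Sum.inl i)
      simp [vecMul_sub, vecMul_smul] at this
      simp [← this]
    · have := congrFun hw' (Sum.inr i)
      simpa [vecMul_neg] using this
  · rintro ⟨w, hw1, hw2⟩
    have h1 : η ᵥ* D.map (algebraMap ℝ ℂ) = w ᵥ* (s • 1 - A.map (algebraMap ℝ ℂ)) := by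
      rw [vecMul_sub, vecMul_smul, vecMul_one, ← hw1, add_sub_cancel_left]
    rw [← e2, ← vecMul_vecMul, h1, vecMul_vecMul, e1, ← vecMul_vecMul, hw2, zero_vecMul]

theorem exists_isRightCoprimeFactorization_transferMatrix (A : Matrix m m ℝ) (B : Matrix m k ℝ)
    (D : Matrix l m ℝ) :
    ∃ N M, IsRightCoprimeFactorization (transferMatrix A B D 0) N M := by
  refine exists_isRightCoprimeFactorization _ (transferNumerator A B D 0)
    A.charpoly_monic.ne_zero fun i j => ?_
  have : algebraMap ℝ[X] (RatFunc ℝ) A.charpoly ≠ 0 := by simpa using A.charpoly_monic.ne_zero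
  rw [transferMatrix_apply, mul_div_cancel₀ _ this]

end Zeros

/-! ### The servo-compensator -/

section Servo

open Matrix

variable {n r d p β : ℕ} {A : Matrix (Fin n) (Fin n) ℝ} {B : Matrix (Fin n) (Fin r) ℝ}
  {E : Matrix (Fin n) (Fin p) ℝ} {D : Matrix (Fin d) (Fin n) ℝ} {φ : ℝ[X]}

/-- The reference and the disturbance together are the input, and the tracking error the output, of
the closed loop. -/
theorem achievesTracking_of_dvd_num {κ : Type*} [Fintype κ] [DecidableEq κ] (hφ : φ.Monic)
    {F : Matrix κ κ ℝ} {Γ : Matrix κ (Fin d) ℝ} {K₁ : Matrix (Fin r) (Fin n) ℝ}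
    {K₂ : Matrix (Fin r) κ ℝ} (hH : IsHurwitz (closedLoop A B D F Γ K₁ K₂))
    (hdvd : ∀ i j, φ ∣ (errorTransfer A B E D F Γ K₁ K₂ i j).num) :
    AchievesTracking φ A B E D F Γ K₁ K₂ := by
  intro t₀ w zref x q hw hz hx hq
  have h := tendsto_output_zero (t₀ := t₀) (x := fun t => Sum.elim (x t) (q t))
    (v := fun t => Sum.elim (zref t) (w t)) hH hφ
    (fun i j => dvd_transferNumerator_of_dvd_num (hdvd i j)) ?_ ?_
  · refine h.congr fun t => ?_
    rw [fromCols_mulVec_sumElim, fromCols_mulVec_sumElim]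
    simp [neg_mulVec, sub_eq_add_neg]
  · rintro (j | j)
    · exact hz j
    · exact hw j
  · intro t ht
    have e : closedLoop A B D F Γ K₁ K₂ *ᵥ Sum.elim (x t) (q t) +
        (fromBlocks 0 E (-Γ) 0 : Matrix (Fin n ⊕ κ) (Fin d ⊕ Fin p) ℝ) *ᵥ Sum.elim (zref t) (w t) =
        Sum.elim (A *ᵥ x t + B *ᵥ (K₁ *ᵥ x t + K₂ *ᵥ q t) + E *ᵥ w t)
          (F *ᵥ q t + Γ *ᵥ (D *ᵥ x t - zref t)) := by
      rw [closedLoop, fromBlocks_mulVec, fromBlocks_mulVec]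
      ext (i | i)
      · simp [add_mulVec, mulVec_add]
        ring
      · simp [mulVec_sub, neg_mulVec]
        ring
    rw [e, hasDerivWithinAt_pi]
    rintro (i | i)
    · exact hasDerivWithinAt_pi.1 (hx t ht) i
    · exact hasDerivWithinAt_pi.1 (hq t ht) i

variable {F : Fin d → Matrix (Fin β) (Fin β) ℝ} {γ : Fin d → Fin β → ℝ}

/-- The internal model principle. If no root of `φ` is a closed-loop eigenvalue, then all pairs
`(F i, γ i)` are controllable, and no factor of `φ` cancels against the closed-loop characteristic
polynomial. -/
theorem dvd_num_errorTransfer (hF : ∀ i, (F i).charpoly = φ)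
    {K₁ : Matrix (Fin r) (Fin n) ℝ} {K₂ : Matrix (Fin r) (Fin β × Fin d) ℝ}
    (h : ∀ s : ℂ, aeval s φ = 0 →
      aeval s (closedLoop A B D (blockDiagonal F) (servoGamma γ) K₁ K₂).charpoly ≠ 0)
    (i : Fin d) (j : Fin d ⊕ Fin p) :
    φ ∣ (errorTransfer A B E D (blockDiagonal F) (servoGamma γ) K₁ K₂ i j).num := by
  refine dvd_num_of_dvd_transferNumerator ?_ ?_
  · refine (isCoprime_iff_aeval_ne_zero_of_isAlgClosed (k := ℝ) ℂ φ _).2 fun s => ?_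
    by_cases hs : aeval s φ = 0
    · exact Or.inr (h s hs)
    · exact Or.inl hs
  · rw [← hF i]
    refine charpoly_dvd_errorNumerator (fun s => ?_) j
    by_cases hs : aeval s φ = 0
    · have := h s hs
      rw [closedLoop_eq] at this
      exact (HautusAt.of_charpoly_ne_zero this).block i
    -- away from the eigenvalues of the block the condition is empty
    · intro w hw _
      by_contra h0
      exact hs (hF i ▸ (aeval_charpoly_eq_zero_iff _ _).2 ⟨w, h0, hw⟩)

/-- At a root of the model polynomial, the Hautus condition for the augmented pair says that the
system matrix `[s I - A, B; -D, 0]` has full row rank: each block has a left eigenvector `y i` with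
`y i ⬝ᵥ γ i ≠ 0`, so that the vectors `η` with the components `y i ⬝ᵥ γ i` are arbitrary. -/
theorem HautusAt.eq_zero_of_systemMatrix {s : ℂ}
    (h : HautusAt (augmentedA A D (blockDiagonal F) (servoGamma γ)) (augmentedB (Fin β × Fin d) B)
        s)
    (hs : ∀ i, aeval s (F i).charpoly = 0) {w : Fin n → ℂ} {η : Fin d → ℂ}
    (h1 : w ᵥ* A.map (algebraMap ℝ ℂ) + η ᵥ* D.map (algebraMap ℝ ℂ) = s • w)
    (h2 : w ᵥ* B.map (algebraMap ℝ ℂ) = 0) : η = 0 := by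
  have hv : ∀ i, ∃ v : Fin β → ℂ, v ᵥ* (F i).map (algebraMap ℝ ℂ) = s • v ∧
      v ⬝ᵥ (algebraMap ℝ ℂ ∘ γ i) ≠ 0 := by
    intro i
    obtain ⟨v, hv0, hv⟩ := (aeval_charpoly_eq_zero_iff _ _).1 (hs i)
    refine ⟨v, hv, fun h0 => hv0 (h.block i v hv ?_)⟩
    ext
    simpa [vecMul, dotProduct] using h0
  choose v hv hvγ using hv
  set y : Fin d → Fin β → ℂ := fun i => (η i / (v i ⬝ᵥ (algebraMap ℝ ℂ ∘ γ i))) • v i with hy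
  have hyη : (fun i => y i ⬝ᵥ (algebraMap ℝ ℂ ∘ γ i)) = η := by
    ext i
    simp only [hy, smul_dotProduct, smul_eq_mul]
    exact div_mul_cancel₀ _ (hvγ i)
  have h3 := hautusAt_augmented_iff.1 h w y (by rw [hyη, h1])
    (fun i => by simp only [hy]; rw [smul_vecMul, hv, smul_comm]) h2
  rw [← hyη, h3.2]
  ext
  simp

/-- Off the roots of `φ` only the plant matters in the Hautus test of the augmented pair. At a root,
the test also requires the left kernel of the system matrix, which is that of the numerator of the
transfer matrix, to be trivial, and no block to have a left eigenvector orthogonal to `γ i`. -/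
theorem isStabilizable_augmented_iff (hβ : 0 < β) (hobs : IsObservablePair A D)
    (hdeg : φ.natDegree = β) (hroots : ∀ s : ℂ, aeval s φ = 0 → 0 ≤ s.re)
    (hF : ∀ i, (F i).charpoly = φ) :
    IsStabilizable (augmentedA A D (blockDiagonal F) (servoGamma γ))
        (augmentedB (Fin β × Fin d) B) ↔
      IsStabilizable A B ∧ d ≤ r ∧
      (∀ s : ℂ, aeval s φ = 0 → ¬ IsTransmissionZero (transferMatrix A B D 0) s) ∧
      ∀ i, IsStabilizable (F i) (replicateCol (Fin 1) (γ i)) := by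
  simp only [isStabilizable_iff_hautusAt]
  constructor
  · intro h
    have hplant : ∀ s : ℂ, 0 ≤ s.re → HautusAt A B s := fun s hs => (h s hs).plant
    have hrank : ∀ s : ℂ, aeval s φ = 0 → ∀ N M,
        IsRightCoprimeFactorization (transferMatrix A B D 0) N M →
        (N.map (aeval s)).rank = Fintype.card (Fin d) := by
      intro s hs N M hNM
      refine (rank_eq_card_iff _).2 fun η hη => ?_
      obtain ⟨w, hw, hwB⟩ :=
        (vecMul_numerator_eq_zero_iff hobs hNM (hplant s (hroots s hs)) η).1 hη
      exact (h s (hroots s hs)).eq_zero_of_systemMatrix (fun i => (hF i).symm ▸ hs) hw hwB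
    refine ⟨hplant, ?_, ?_, fun i s hs => (h s hs).block i⟩
    · obtain ⟨s, hs⟩ := IsAlgClosed.exists_aeval_eq_zero ℂ φ
        fun h0 => by
        rw [natDegree_eq_of_degree_eq_some h0] at hdeg
        exact hβ.ne hdeg
      obtain ⟨N, M, hNM⟩ := exists_isRightCoprimeFactorization_transferMatrix A B D
      have := (N.map (aeval s)).rank_le_card_width
      rw [hrank s hs N M hNM] at this
      simpa using this
    · rintro s hs ⟨N, M, hNM, hlt⟩
      rw [hrank s hs N M hNM] at hlt
      exact absurd hlt (not_lt.2 (min_le_left _ _))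
  · rintro ⟨ha, hb, hc, hd⟩ s hs
    rw [hautusAt_augmented_iff]
    intro w y h1 h2 h3
    have hη : (fun i => y i ⬝ᵥ (algebraMap ℝ ℂ ∘ γ i)) = 0 := by
      by_cases hy : y = 0
      · ext
        simp [hy]
      obtain ⟨i, hi⟩ := Function.ne_iff.1 hy
      have hφs : aeval s φ = 0 := hF i ▸ (aeval_charpoly_eq_zero_iff _ _).2 ⟨y i, hi, h2 i⟩
      obtain ⟨N, M, hNM⟩ := exists_isRightCoprimeFactorization_transferMatrix A B D
      have hrank : (N.map (aeval s)).rank = Fintype.card (Fin d) := by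
        refine le_antisymm (rank_le_card_height _) (not_lt.1 fun hlt => hc s hφs ⟨N, M, hNM, ?_⟩)
        simpa [hb] using hlt
      exact (rank_eq_card_iff _).1 hrank _
        ((vecMul_numerator_eq_zero_iff hobs hNM (ha s hs) _).2 ⟨w, h1, h3⟩)
    refine ⟨ha s hs w (by rw [← h1, hη, zero_vecMul, add_zero]) h3, funext fun i => hd i s hs _ (h2
        i) ?_⟩
    ext
    simpa [vecMul, dotProduct] using congrFun hη i

end Servo

theorem theorem10p2 {n r d p β : ℕ} (hβ : 0 < β)
    (A : Matrix (Fin n) (Fin n) ℝ) (B : Matrix (Fin n) (Fin r) ℝ)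
    (E : Matrix (Fin n) (Fin p) ℝ) (D : Matrix (Fin d) (Fin n) ℝ)
    (hobs : IsObservablePair A D)
    (φ : ℝ[X]) (hφ : φ.Monic) (hdeg : φ.natDegree = β)
    (hroots : ∀ s : ℂ, aeval s φ = 0 → 0 ≤ s.re)
    (F : Fin d → Matrix (Fin β) (Fin β) ℝ) (hF : ∀ i, (F i).charpoly = φ)
    (γ : Fin d → Fin β → ℝ) :
    -- the stabilized loop tracks if the numerators of its error transfer matrix contain the model
    (∀ (F' : Matrix (Fin β × Fin d) (Fin β × Fin d) ℝ) (Γ' : Matrix (Fin β × Fin d) (Fin d) ℝ)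
        (K₁ : Matrix (Fin r) (Fin n) ℝ) (K₂ : Matrix (Fin r) (Fin β × Fin d) ℝ),
      IsHurwitz (closedLoop A B D F' Γ' K₁ K₂) →
      (∀ i j, φ ∣ (errorTransfer A B E D F' Γ' K₁ K₂ i j).num) →
      AchievesTracking φ A B E D F' Γ' K₁ K₂) ∧
    -- the structured compensator puts the model into these numerators
    (∀ (K₁ : Matrix (Fin r) (Fin n) ℝ) (K₂ : Matrix (Fin r) (Fin β × Fin d) ℝ),
      (∀ s : ℂ, aeval s φ = 0 →
        aeval s (closedLoop A B D (Matrix.blockDiagonal F) (servoGamma γ) K₁ K₂).charpoly ≠ 0) →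
      ∀ i j, φ ∣ (errorTransfer A B E D (Matrix.blockDiagonal F) (servoGamma γ) K₁ K₂ i j).num) ∧
    -- stabilizability of the augmented pair
    (IsStabilizable (augmentedA A D (Matrix.blockDiagonal F) (servoGamma γ))
        (augmentedB (Fin β × Fin d) B) ↔
      IsStabilizable A B ∧ d ≤ r ∧
      (∀ s : ℂ, aeval s φ = 0 → ¬ IsTransmissionZero (transferMatrix A B D 0) s) ∧
      ∀ i, IsStabilizable (F i) (Matrix.replicateCol (Fin 1) (γ i))) ∧
    -- sufficient conditions for the servo-compensator
    (IsStabilizable A B → d ≤ r →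
      (∀ s : ℂ, aeval s φ = 0 → ¬ IsTransmissionZero (transferMatrix A B D 0) s) →
      (∀ i, IsStabilizable (F i) (Matrix.replicateCol (Fin 1) (γ i))) →
      ∃ (K₁ : Matrix (Fin r) (Fin n) ℝ) (K₂ : Matrix (Fin r) (Fin β × Fin d) ℝ),
        IsHurwitz (closedLoop A B D (Matrix.blockDiagonal F) (servoGamma γ) K₁ K₂) ∧
        AchievesTracking φ A B E D (Matrix.blockDiagonal F) (servoGamma γ) K₁ K₂) := by
  refine ⟨fun F' Γ' K₁ K₂ => achievesTracking_of_dvd_num hφ,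
    fun K₁ K₂ h => dvd_num_errorTransfer hF h,
    isStabilizable_augmented_iff hβ hobs hdeg hroots hF, fun ha hb hc hd => ?_⟩
  obtain ⟨K, hK⟩ := (isStabilizable_augmented_iff hβ hobs hdeg hroots hF).2 ⟨ha, hb, hc, hd⟩
  rw [← Matrix.fromCols_toCols K, ← closedLoop_eq] at hK
  refine ⟨_, _, hK, achievesTracking_of_dvd_num hφ hK (dvd_num_errorTransfer hF ?_)⟩
  -- the roots of the model polynomial lie in the closed right half-plane
  exact fun s hs h0 => absurd (hroots s hs) (not_le.2 (hK s h0))
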